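/- Let $p$ be an odd prime and let $R$ be a commutative $\mathbb{Z}_{(p)}$-algebra without $p$-torsion. Let $R/\!\!/p$ be the differential graded $R$-algebra whose underlying graded algebra is $R[x]$ with $x$ in degree $1$ and whose differential, of degree $-1$ and satisfying the graded Leibniz rule, is determined by $\delta x=p$; thus $\delta(x^n)=p\,x^{n-1}$ for $n$ odd and $\delta(x^n)=0$ for $n$ even. Let $\mathrm{HC}_i(R/\!\!/p)$ denote its $i$-th cyclic homology module over $R$, that is, the homology in degree $i$ of the total complex of the cyclic $(b,B)$-bicomplex of this differential graded $R$-algebra (tensor products over $R$, Koszul signs). Define rational numbers $A_j$ for odd $j\ge 1$ by $A_1=p$ and $A_j=p^2A_{j-2}/j$ for $j\ge 3$, and let $a_j=\nu_p(A_j)$ be the $p$-adic valuation, which is a non-negative integer. Then $\mathrm{HC}_i(R/\!\!/p)=0$ for all odd $i$, and $\mathrm{HC}_0(R/\!\!/p)\cong R/p$ as $R$-modules. Furthermore, there is an infinite set $Z$ of positive even integers such that for every $i\in Z$ there is an isomorphism of $R$-modules \[ \mathrm{HC}_i(R/\!\!/p)\;\cong\; R/p^{a_{i-1}+2}\oplus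 R/1\oplus R/3\oplus\cdots\oplus R/(i-1), \] where the last summands run over the odd integers from $1$ to $i-1$. The set $Z$ contains all even numbers of the form $\frac{p^a+1}{2}+1$ or $\frac{p^a-1}{2}+1$ with $a>0$. -/

import Mathlib

open scoped TensorProduct Polynomial

/-- A (homologically graded, non-negatively graded) differential graded `R`-algebra with underlying
`R`-algebra `A`: a grading of `A` and a square-zero differential of degree `-1` that satisfies the
graded Leibniz rule. -/
structure DGAlg (R : Type*) (A : Type*) [CommRing R] [Ring A] [Algebra R A] where
  /-- the homogeneous parts -/
  gr : ℕ → Submodule R A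
  /-- they form an algebra grading -/
  [graded : GradedAlgebra gr]
  /-- the differential -/
  d : A →ₗ[R] A
  d_zero : ∀ a ∈ gr 0, d a = 0
  d_mem : ∀ n, ∀ a ∈ gr (n + 1), d a ∈ gr n
  d_d : ∀ a, d (d a) = 0
  leibniz : ∀ n, ∀ a ∈ gr n, ∀ b, d (a * b) = d a * b + (-1 : A) ^ n * (a * d b)

namespace Hoch

variable (R : Type*) (A : Type*) [CommRing R] [Ring A] [Algebra R A]

/-- `A ⊗ ⋯ ⊗ A` over `R`, with `n + 1` factors: the Hochschild chains of Hochschild degree `n`. -/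
abbrev Chain (n : ℕ) : Type _ := ⨂[R] _ : Fin (n + 1), A

theorem contractNth_update {n : ℕ} [DecidableEq (Fin (n + 2))] (j : Fin (n + 1))
    (a : Fin (n + 2) → A) (i : Fin (n + 2)) (u : A) :
    ∃ (k : Fin (n + 1)) (l r : A), (∀ x : A,
      Fin.contractNth j.castSucc (· * ·) (Function.update a i x) =
        Function.update (Fin.contractNth j.castSucc (· * ·) (Function.update a i u)) k
          (l * x * r)) := by
  classical
  rcases lt_trichotomy (i : ℕ) (j : ℕ) with h | h | h
  · refine ⟨⟨i, by omega⟩, 1, 1, fun x => ?_⟩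
    funext k
    simp only [Fin.contractNth, Function.update_apply, Fin.ext_iff, Fin.val_castSucc, Fin.val_succ]
    split_ifs <;> first | omega | simp
  · refine ⟨⟨i, by omega⟩, 1, a (Fin.succ j), fun x => ?_⟩
    funext k
    simp only [Fin.contractNth, Function.update_apply, Fin.ext_iff, Fin.val_castSucc, Fin.val_succ]
    split_ifs <;> first | omega | (simp; done) | skip
    have : k = j := Fin.ext (by omega)
    subst this
    simp
  · rcases Nat.eq_or_lt_of_le (Nat.succ_le_of_lt h) with h' | h'
    · refine ⟨j, a (Fin.castSucc j), 1, fun x => ?_⟩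
      funext k
      simp only [Fin.contractNth, Function.update_apply, Fin.ext_iff, Fin.val_castSucc,
        Fin.val_succ]
      split_ifs <;> first | omega | (simp; done) | skip
      have : k = j := Fin.ext (by omega)
      subst this
      simp
    · refine ⟨⟨i - 1, by omega⟩, 1, 1, fun x => ?_⟩
      funext k
      simp only [Fin.contractNth, Function.update_apply, Fin.ext_iff, Fin.val_castSucc,
        Fin.val_succ]
      split_ifs <;> first | omega | simp

/-- The face map `a₀ ⊗ ⋯ ⊗ aₙ₊₁ ↦ a₀ ⊗ ⋯ ⊗ aⱼ aⱼ₊₁ ⊗ ⋯ ⊗ aₙ₊₁`, for `0 ≤ j ≤ n`. -/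
noncomputable def face {n : ℕ} (j : Fin (n + 1)) : Chain R A (n + 1) →ₗ[R] Chain R A n :=
  PiTensorProduct.lift
    { toFun := fun a => PiTensorProduct.tprod R (Fin.contractNth j.castSucc (· * ·) a)
      map_update_add' := by
        intro _ a i x y
        obtain ⟨k, l, r, h⟩ := contractNth_update A j a i 0
        rw [h, h x, h y, mul_add, add_mul, MultilinearMap.map_update_add]
      map_update_smul' := by
        intro _ a i c x
        obtain ⟨k, l, r, h⟩ := contractNth_update A j a i 0
        rw [h, h x, mul_smul_comm, smul_mul_assoc, MultilinearMap.map_update_smul] }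

/-- The extra degeneracy `a₀ ⊗ ⋯ ⊗ aₙ ↦ 1 ⊗ a₀ ⊗ ⋯ ⊗ aₙ`. -/
noncomputable def extra (n : ℕ) : Chain R A n →ₗ[R] Chain R A (n + 1) :=
  PiTensorProduct.lift
    ((PiTensorProduct.tprod R (s := fun _ : Fin (n + 2) => A)).curryLeft (1 : A))

end Hoch

namespace DGAlg

variable {R : Type*} {A : Type*} [CommRing R] [Ring A] [Algebra R A] (S : DGAlg R A)

/-- The projection of `A` onto the sum of its homogeneous parts of even degree. -/
noncomputable def even : A →ₗ[R] A :=
  letI := S.graded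
  DirectSum.toModule R ℕ A (fun n => if Even n then (S.gr n).subtype else 0) ∘ₗ
    (DirectSum.decomposeLinearEquiv S.gr).toLinearMap

/-- The projection of `A` onto the sum of its homogeneous parts of odd degree. -/
noncomputable def odd : A →ₗ[R] A := LinearMap.id - S.even

/-- The sign operator `a ↦ (-1)^|a| a`. -/
noncomputable def sgn : A →ₗ[R] A := S.even - S.odd

/-- The graded cyclic rotation
`a₀ ⊗ ⋯ ⊗ aₙ ↦ (-1)^(|aₙ| (|a₀| + ⋯ + |aₙ₋₁|)) aₙ ⊗ a₀ ⊗ ⋯ ⊗ aₙ₋₁`: the Koszul sign is trivial on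
the even part of `aₙ`, and on its odd part it amounts to applying the sign operator to
`a₀, …, aₙ₋₁`. -/
noncomputable def rot (n : ℕ) : Hoch.Chain R A n →ₗ[R] Hoch.Chain R A n :=
  (PiTensorProduct.reindex R (fun _ => A) (finRotate (n + 1))).toLinearMap ∘ₗ
    (PiTensorProduct.map (fun i => if i = Fin.last n then S.even else LinearMap.id) +
      PiTensorProduct.map (fun i => if i = Fin.last n then S.odd else S.sgn))

/-- The cyclic operator `t = (-1)^n · (graded cyclic rotation)`. -/
noncomputable def cyc (n : ℕ) : Hoch.Chain R A n →ₗ[R] Hoch.Chain R A n :=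
  (-1 : R) ^ n • S.rot n

/-- The norm operator `N = 1 + t + ⋯ + tⁿ`. -/
noncomputable def norm (n : ℕ) : Hoch.Chain R A n →ₗ[R] Hoch.Chain R A n :=
  ∑ i ∈ Finset.range (n + 1), S.cyc n ^ i

/-- The Hochschild boundary `b = ∑ⱼ (-1)ʲ dⱼ` on chains of Hochschild degree `n + 1`. The last
face map is `dₙ₊₁(a₀ ⊗ ⋯ ⊗ aₙ₊₁) = ± aₙ₊₁ a₀ ⊗ a₁ ⊗ ⋯ ⊗ aₙ` with its Koszul sign, that is, the
graded cyclic rotation followed by `d₀`. -/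
noncomputable def b (n : ℕ) : Hoch.Chain R A (n + 1) →ₗ[R] Hoch.Chain R A n :=
  (∑ j : Fin (n + 1), (-1 : R) ^ (j : ℕ) • Hoch.face R A j) +
    (-1 : R) ^ (n + 1) • (Hoch.face R A 0 ∘ₗ S.rot (n + 1))

/-- Connes' operator `B = (1 - t) s N`. -/
noncomputable def connes (n : ℕ) : Hoch.Chain R A n →ₗ[R] Hoch.Chain R A (n + 1) :=
  (LinearMap.id - S.cyc (n + 1)) ∘ₗ Hoch.extra R A n ∘ₗ S.norm n

/-- The differential of the tensor product complex `A ⊗ ⋯ ⊗ A`: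
`a₀ ⊗ ⋯ ⊗ aₙ ↦ ∑ᵢ (-1)^(|a₀| + ⋯ + |aᵢ₋₁|) a₀ ⊗ ⋯ ⊗ d aᵢ ⊗ ⋯ ⊗ aₙ`. -/
noncomputable def inner (n : ℕ) : Hoch.Chain R A n →ₗ[R] Hoch.Chain R A n :=
  ∑ i : Fin (n + 1), PiTensorProduct.map
    (fun j => if j < i then S.sgn else if j = i then S.d else LinearMap.id)

/-- The part of `A^{⊗ (n+1)}` of internal degree `q`: it is spanned by the tensors `a₀ ⊗ ⋯ ⊗ aₙ` of
homogeneous elements with `|a₀| + ⋯ + |aₙ| = q`. -/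
def chainDeg (n : ℕ) (q : ℤ) : Submodule R (Hoch.Chain R A n) :=
  Submodule.span R {z | ∃ (e : Fin (n + 1) → ℕ) (a : Fin (n + 1) → A),
    (∀ i, a i ∈ S.gr (e i)) ∧ ∑ i, (e i : ℤ) = q ∧ z = PiTensorProduct.tprod R a}

/-- The families of Hochschild chains, one chain `f k n` of Hochschild degree `n` for every column
`k` of the cyclic `(b, B)`-bicomplex of `S`. -/
abbrev Tot (_ : DGAlg R A) : Type _ := (k n : ℕ) → Hoch.Chain R A n

/-- The contribution of Connes' operator to the total differential, from column `k + 1` to column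
`k`; it does not reach Hochschild degree `0`. -/
noncomputable def totConnes (k : ℕ) : (n : ℕ) → S.Tot →ₗ[R] Hoch.Chain R A n
  | 0 => 0
  | n + 1 => S.connes n ∘ₗ LinearMap.proj n ∘ₗ LinearMap.proj (k + 1)

/-- The total differential: `b + (-1)ⁿ d + B` on chains of Hochschild degree `n`. -/
noncomputable def totD : S.Tot →ₗ[R] S.Tot :=
  LinearMap.pi fun k => LinearMap.pi fun n =>
    S.b n ∘ₗ LinearMap.proj (n + 1) ∘ₗ LinearMap.proj k +
      (-1 : R) ^ n • (S.inner n ∘ₗ LinearMap.proj n ∘ₗ LinearMap.proj k) +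
      S.totConnes k n

/-- The term of degree `m` of the total complex of the cyclic `(b, B)`-bicomplex: the chains of
Hochschild degree `n` and internal degree `q` in column `k` have total degree `2k + n + q`. For
given `m`, only finitely many of the entries `f k n` can be non-zero. -/
def totDeg (m : ℤ) : Submodule R S.Tot :=
  Submodule.pi Set.univ fun k : ℕ => Submodule.pi Set.univ fun n : ℕ =>
    S.chainDeg n (m - 2 * k - n)

/-- The cycles of total degree `m`. -/
noncomputable def cycles (m : ℤ) : Submodule R S.Tot :=
  S.totDeg m ⊓ LinearMap.ker S.totD

/-- The boundaries of total degree `m`. -/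
noncomputable def boundaries (m : ℤ) : Submodule R S.Tot :=
  (S.totDeg (m + 1)).map S.totD

/-- The cyclic homology `HC_m` over `R` of a differential graded `R`-algebra whose underlying
`R`-module is flat (so that no derived tensor products are needed): the homology in degree `m` of
the total complex of its cyclic `(b, B)`-bicomplex. -/
abbrev HC (m : ℤ) : Type _ := S.cycles m ⧸ (S.boundaries m).submoduleOf (S.cycles m)

end DGAlg

namespace KillP

variable (R : Type*) [CommRing R]

/-- The homogeneous part of degree `n` of `R[x]`, where `x` has degree `1`. -/
noncomputable def gr (n : ℕ) : Submodule R R[X] := LinearMap.range (Polynomial.monomial n)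

theorem X_mem : (Polynomial.X : R[X]) ∈ gr R 1 := ⟨1, rfl⟩

instance gradedMonoid : SetLike.GradedMonoid (gr R) where
  one_mem := ⟨1, rfl⟩
  mul_mem := by
    rintro i j _ _ ⟨r, rfl⟩ ⟨s, rfl⟩
    exact ⟨r * s, (Polynomial.monomial_mul_monomial i j r s).symm⟩

noncomputable instance graded : GradedAlgebra (gr R) :=
  GradedAlgebra.ofAlgHom (gr R)
    (Polynomial.aeval (DirectSum.of (fun n => gr R n) 1 ⟨Polynomial.X, X_mem R⟩))
    (by
      ext
      simp)
    (by
      rintro i ⟨_, r, rfl⟩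
      simp only [← Polynomial.C_mul_X_pow_eq_monomial, map_mul, map_pow, Polynomial.aeval_X,
        Polynomial.aeval_C, DirectSum.ofPow]
      rw [← Algebra.smul_def]
      refine ((DirectSum.lof R ℕ (fun n => gr R n) _).map_smul r _).symm.trans ?_
      refine DirectSum.of_eq_of_gradedMonoid_eq (Sigma.subtype_ext (mul_one i) ?_)
      exact Polynomial.smul_eq_C_mul r)

/-- The differential of `R // p`: `δ(xⁿ) = p xⁿ⁻¹` for odd `n`, and `δ(xⁿ) = 0` for even `n`. -/
noncomputable def delta (p : ℕ) : R[X] →ₗ[R] R[X] :=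
  Polynomial.lsum fun n => if Odd n then (p : R) • Polynomial.monomial (n - 1) else 0

theorem delta_monomial (p n : ℕ) (r : R) : delta R p (Polynomial.monomial n r) =
    if Odd n then (p : R) • Polynomial.monomial (n - 1) r else 0 := by
  unfold delta
  rw [Polynomial.lsum_apply, Polynomial.sum_monomial_index _ _ (by simp)]
  split_ifs <;> simp

/-- The differential graded `R`-algebra `R // p`: the graded algebra `R[x]` with `x` in degree `1`
and differential determined by `δ x = p`. -/
noncomputable def alg (p : ℕ) : DGAlg R R[X] where
  gr := gr R
  d := delta R p
  d_zero := by
    rintro _ ⟨r, rfl⟩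
    rw [delta_monomial, if_neg (by decide)]
  d_mem := by
    rintro n _ ⟨r, rfl⟩
    rw [delta_monomial]
    split_ifs
    · exact Submodule.smul_mem _ _ ⟨r, rfl⟩
    · exact Submodule.zero_mem _
  d_d := by
    intro a
    induction a using Polynomial.induction_on' with
    | add a b ha hb => rw [map_add, map_add, ha, hb, add_zero]
    | monomial n r =>
      rw [delta_monomial]
      split_ifs with h
      · rw [map_smul, delta_monomial, if_neg, smul_zero]
        rw [Nat.not_odd_iff_even]
        exact Nat.Odd.sub_odd h odd_one
      · exact map_zero _
  leibniz := by
    rintro n _ ⟨r, rfl⟩ b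
    induction b using Polynomial.induction_on' with
    | add a b ha hb => rw [mul_add, map_add, ha, hb, map_add]; ring
    | monomial m s =>
      rw [Polynomial.monomial_mul_monomial, delta_monomial, delta_monomial, delta_monomial]
      rcases Nat.even_or_odd n with hn | hn <;> rcases Nat.even_or_odd m with hm | hm
      · rw [if_neg (Nat.not_odd_iff_even.2 (hn.add hm)), if_neg (Nat.not_odd_iff_even.2 hn),
          if_neg (Nat.not_odd_iff_even.2 hm)]
        simp
      · rw [if_pos (hn.add_odd hm), if_neg (Nat.not_odd_iff_even.2 hn), if_pos hm, hn.neg_one_pow]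
        have : n + m - 1 = n + (m - 1) := by have := hm.pos; omega
        rw [this, mul_smul_comm, Polynomial.monomial_mul_monomial]
        simp
      · rw [if_pos (hn.add_even hm), if_pos hn, if_neg (Nat.not_odd_iff_even.2 hm)]
        have : n + m - 1 = n - 1 + m := by have := hn.pos; omega
        rw [this, smul_mul_assoc, Polynomial.monomial_mul_monomial]
        simp
      · rw [if_neg (Nat.not_odd_iff_even.2 (hn.add_odd hm)), if_pos hn, if_pos hm, hn.neg_one_pow,
          mul_smul_comm, smul_mul_assoc, Polynomial.monomial_mul_monomial,
          Polynomial.monomial_mul_monomial]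
        have : n + (m - 1) = n - 1 + m := by have := hm.pos; have := hn.pos; omega
        rw [this]
        simp

/-- The prime ideal `(p)` of `ℤ`. -/
instance isPrime_span (p : ℕ) [hp : Fact p.Prime] : (Ideal.span {(p : ℤ)}).IsPrime :=
  (Ideal.span_singleton_prime (by exact_mod_cast hp.out.ne_zero)).2
    (Nat.prime_iff_prime_int.1 hp.out)

/-- The ring `ℤ_(p)`. -/
abbrev ZLoc (p : ℕ) [Fact p.Prime] : Type := Localization.AtPrime (Ideal.span {(p : ℤ)})

/-- `A₁ = p` and `A_j = p² A_{j-2} / j` for odd `j ≥ 3`; only odd indices are meaningful. -/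
def seqA (p : ℕ) : ℕ → ℚ
  | 0 => 0
  | 1 => p
  | j + 2 => (p : ℚ) ^ 2 * seqA p j / ((j + 2 : ℕ) : ℚ)

/-- `a_j = ν_p(A_j)` for odd `j`, see `coe_seqa`. -/
def seqa (p j : ℕ) : ℕ := (padicValRat p (seqA p j)).toNat

theorem seqA_spec (p : ℕ) [hp : Fact p.Prime] (m : ℕ) : seqA p (2 * m + 1) ≠ 0 ∧
    (2 * m + 1 : ℤ) ≤ padicValRat p (seqA p (2 * m + 1)) +
      padicValNat p (2 * m + 1).factorial := by
  have hp0 : (p : ℚ) ≠ 0 := by exact_mod_cast hp.out.ne_zero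
  induction m with
  | zero => simp [seqA, hp.out.ne_zero, padicValRat.self hp.out.one_lt]
  | succ m ih =>
    obtain ⟨h0, h1⟩ := ih
    have e : 2 * (m + 1) + 1 = (2 * m + 1) + 2 := by ring
    have hj : (((2 * m + 1) + 2 : ℕ) : ℚ) ≠ 0 := by positivity
    rw [e, seqA]
    refine ⟨div_ne_zero (mul_ne_zero (pow_ne_zero _ hp0) h0) hj, ?_⟩
    rw [padicValRat.div (mul_ne_zero (pow_ne_zero _ hp0) h0) hj,
      padicValRat.mul (pow_ne_zero _ hp0) h0, padicValRat.pow,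
      padicValRat.self hp.out.one_lt, padicValRat.of_nat, Nat.factorial_succ, Nat.factorial_succ,
      padicValNat.mul (by omega) (by positivity),
      padicValNat.mul (by omega) (by positivity)]
    have e3 : padicValNat p (2 * m + 1 + 2) = padicValNat p (2 * m + 1 + 1 + 1) := rfl
    rw [e3]
    generalize padicValNat p (2 * m + 1 + 1 + 1) = u
    generalize padicValNat p (2 * m + 1 + 1) = v
    generalize padicValNat p (2 * m + 1).factorial = w at *
    rw [Nat.cast_add, Nat.cast_add]
    generalize padicValRat p (seqA p (2 * m + 1)) = z at *
    push_cast
    have : (0 : ℤ) ≤ v := by positivity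
    linarith

/-- The valuations `a_j`, `j` odd, are non-negative. -/
theorem coe_seqa (p : ℕ) [hp : Fact p.Prime] (j : ℕ) (hj : Odd j) :
    (seqa p j : ℤ) = padicValRat p (seqA p j) := by
  obtain ⟨m, rfl⟩ := hj
  have h1 := (seqA_spec p m).2
  have h2 : padicValNat p (2 * m + 1).factorial ≤ 2 * m + 1 := by
    have h := sub_one_mul_padicValNat_factorial (p := p) (2 * m + 1)
    have hp2 : 1 ≤ p - 1 := by have := hp.out.two_le; omega
    have := Nat.le_mul_of_pos_left (padicValNat p (2 * m + 1).factorial) hp2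
    omega
  unfold seqa
  rw [Int.toNat_of_nonneg]
  have h3 : (padicValNat p (2 * m + 1).factorial : ℤ) ≤ 2 * m + 1 := by exact_mod_cast h2
  linarith

end KillP

/-!
The proof compares the cyclic `(b, B)`-bicomplex of `R // p` with a small complex of differential
forms and then diagonalizes an explicit bidiagonal matrix.

*Small model.* The underlying graded algebra `A = R[x]` is a tensor algebra on one generator of odd
degree. Hence its Hochschild complex is quasi-isomorphic to the two-term complex
`A dx → A` of forms modulo graded commutators, through `a ↦ a` and `a₀ ⊗ a₁ ↦ a₀ da₁`. The homotopy
`htpy` makes this explicit: `b_htpy` says that it contracts the complex in Hochschild degrees at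
least two, and `b_htpy_one` identifies what survives in degree one. The projection to forms is
compatible with `b`, the inner differential and `B` (`coefX_totD`, `coefY_totD`). A zigzag along the
Hochschild degree, which uses that the total differential squares to zero (`totD_totD`), shows that
a cycle with trivial projection is a boundary (`exists_totD_eq_of_coef`).

*Homology of the small model.* On `A dx → A` one has `b(x^(m-1) dx) = 2 x^m` for even `m > 0` and `0`
for odd `m`, while `B(x^m) = m x^(m-1) dx` for odd `m`. Since `2` is invertible, the even powers of
`x` other than `1` cancel against the forms `x^(m-1) dx` with `m` even. What remains is free on
`u^k` and `u^k x^(m-1) dx`, `m` odd, in even degrees, and on `u^k x^m`, `m` odd, in odd degrees. Up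
to rescaling, the differential sends `u^k x^(2l+1)` to `p² u^k x^(2l-2) dx + 2(2l+1) u^(k-1)
x^(2l) dx`, with `p u^k` in place of the first term for `l = 0`; this is `bidiag`. It is injective
because `R` has no `p`-torsion, which gives the vanishing in odd degrees
(`subsingleton_HC_of_odd`); in degree `2h` the homology is the cokernel of `bidiag`
(`HC_even_equiv`).

*The cokernel.* Modulo the relations, every generator is rationally a multiple of the first one,
with the coefficients `A_j`. Together with analogous partial quotients for each of the summands
`R / (2k+1)`, these coefficients are the rows of a unitriangular matrix `U` such that every entry of
the `i`-th row of `U * bidiag` is divisible by the `i`-th expected annihilator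
(`exists_row_zero`, `exists_row_succ`). Comparing determinants, this divisibility already forces `U`
to identify the cokernel with the direct sum (`range_mulVec_iff_dvd`). When a partial quotient
ceases to be integral, the coefficients may be replaced by zero
(`oddVal_le_of_first_failure`). The only remaining condition concerns the last column:
the valuation of the product of the odd numbers from `2k+1` to `2h-1` must not exceed `2(h-k)`. It
holds if `2(2h-1) = p^a ± 1`, since these odd numbers have the same valuations as the small numbers
`4t ± 1` (`oddVal_le_of_pow`).
-/

/-! ### The operators on tensors of monomials -/

namespace KillP

open PiTensorProduct

section Monomials

variable (R : Type*) [CommRing R]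

/-- The tensor `x^(e 0) ⊗ ⋯ ⊗ x^(e n)`. Exponents are recorded by a function on all of `ℕ`, of which
only the values at `0, …, n` matter; this avoids casts between finite index types. -/
noncomputable def mon (n : ℕ) (e : ℕ → ℕ) : Hoch.Chain R R[X] n :=
  tprod R fun i : Fin (n + 1) => Polynomial.monomial (e i) (1 : R)

theorem mon_congr {n : ℕ} {e e' : ℕ → ℕ} (h : ∀ i ≤ n, e i = e' i) : mon R n e = mon R n e' := by
  unfold mon
  congr 1
  funext i
  rw [h i (by omega)]

/-- The basis of `R[x]^{⊗ (n+1)}` formed by the tensors of monomials. -/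
noncomputable def monBasis (n : ℕ) :
    Module.Basis (Fin (n + 1) → ℕ) R (Hoch.Chain R R[X] n) :=
  Basis.piTensorProduct fun _ => Polynomial.basisMonomials R

/-- Extension by zero of a finite family of exponents. -/
def extend {n : ℕ} (e : Fin (n + 1) → ℕ) (i : ℕ) : ℕ := if h : i < n + 1 then e ⟨i, h⟩ else 0

theorem extend_restrict {n : ℕ} (e : ℕ → ℕ) (i : ℕ) (hi : i ≤ n) :
    extend (fun j : Fin (n + 1) => e j) i = e i := by
  simp [extend, Nat.lt_succ_of_le hi]

theorem monBasis_apply (n : ℕ) (e : Fin (n + 1) → ℕ) : monBasis R n e = mon R n (extend e) := by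
  simp [monBasis, mon, extend, Fin.is_le]

theorem mon_eq_monBasis (n : ℕ) (e : ℕ → ℕ) : mon R n e = monBasis R n fun i => e i := by
  rw [monBasis_apply]
  exact mon_congr R fun i hi => (extend_restrict e i hi).symm

variable {R}

theorem chain_ext {M : Type*} [AddCommGroup M] [Module R M] {n : ℕ}
    {f g : Hoch.Chain R R[X] n →ₗ[R] M} (h : ∀ e, f (mon R n e) = g (mon R n e)) : f = g :=
  (monBasis R n).ext fun e => by rw [monBasis_apply, h]

/-- The linear map that takes prescribed values on the tensors of monomials. -/
noncomputable def ofMon {M : Type*} [AddCommGroup M] [Module R M] (n : ℕ) (F : (ℕ → ℕ) → M) :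
    Hoch.Chain R R[X] n →ₗ[R] M :=
  (monBasis R n).constr R fun e => F (extend e)

theorem ofMon_mon {M : Type*} [AddCommGroup M] [Module R M] {n : ℕ} {F : (ℕ → ℕ) → M}
    (hF : ∀ e e' : ℕ → ℕ, (∀ i ≤ n, e i = e' i) → F e = F e') (e : ℕ → ℕ) :
    ofMon n F (mon R n e) = F e := by
  rw [mon_eq_monBasis, ofMon, Module.Basis.constr_basis]
  exact hF _ _ fun i hi => extend_restrict e i hi

/-- The exponents of `x^(e 0) ⊗ ⋯ ⊗ x^(e j) x^(e (j+1)) ⊗ ⋯`. -/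
def contract (j : ℕ) (e : ℕ → ℕ) (k : ℕ) : ℕ :=
  if k < j then e k else if k = j then e k + e (k + 1) else e (k + 1)

/-- The exponents after a new first exponent `c` has been inserted. -/
def push (c : ℕ) (e : ℕ → ℕ) (k : ℕ) : ℕ := if k = 0 then c else e (k - 1)

/-- The total internal degree of the first `n` factors. -/
def tot (n : ℕ) (e : ℕ → ℕ) : ℕ := ∑ i ∈ Finset.range n, e i

@[simp] theorem tot_zero (e : ℕ → ℕ) : tot 0 e = 0 := rfl

theorem tot_succ (n : ℕ) (e : ℕ → ℕ) : tot (n + 1) e = tot n e + e n := Finset.sum_range_succ _ _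

theorem tot_congr {n : ℕ} {e e' : ℕ → ℕ} (h : ∀ i < n, e i = e' i) : tot n e = tot n e' :=
  Finset.sum_congr rfl fun i hi => h i (Finset.mem_range.1 hi)

theorem tot_push (n c : ℕ) (e : ℕ → ℕ) : tot (n + 1) (push c e) = c + tot n e := by
  induction n with
  | zero => simp [tot_succ, push]
  | succ n ih => rw [tot_succ, ih, tot_succ]; simp [push, add_assoc]

theorem tot_contract_of_le {n j : ℕ} (h : n ≤ j) (e : ℕ → ℕ) : tot n (contract j e) = tot n e :=
  tot_congr fun i hi => by simp [contract, lt_of_lt_of_le hi h]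

theorem tot_contract {n j : ℕ} (h : j < n) (e : ℕ → ℕ) :
    tot n (contract j e) = tot (n + 1) e := by
  induction n with
  | zero => omega
  | succ n ih =>
    rcases Nat.lt_or_ge j n with h' | h'
    · rw [tot_succ, ih h', tot_succ (n + 1)]
      simp [contract, h'.ne', h'.not_gt]
    · obtain rfl : j = n := by omega
      rw [tot_succ, tot_contract_of_le le_rfl, tot_succ, tot_succ]
      simp [contract, add_assoc]

theorem face_mon {n : ℕ} (j : Fin (n + 1)) (e : ℕ → ℕ) :
    Hoch.face R R[X] j (mon R (n + 1) e) = mon R n (contract j e) := by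
  unfold Hoch.face mon
  rw [lift.tprod]
  change PiTensorProduct.tprod R _ = _
  congr 1
  funext k
  simp only [Fin.contractNth, contract, Fin.val_castSucc, Fin.val_succ]
  split_ifs <;> simp [Polynomial.monomial_mul_monomial]

theorem extra_mon (n : ℕ) (e : ℕ → ℕ) :
    Hoch.extra R R[X] n (mon R n e) = mon R (n + 1) (push 0 e) := by
  unfold Hoch.extra mon
  rw [lift.tprod]
  rw [MultilinearMap.curryLeft_apply]
  congr 1
  funext k
  refine Fin.cases ?_ (fun k => ?_) k
  · simp [push]
  · simp [push]

variable (R) (p : ℕ)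

theorem even_monomial (m : ℕ) : (alg R p).even (Polynomial.monomial m 1) =
    if Even m then Polynomial.monomial m 1 else 0 := by
  have hm : (Polynomial.monomial m (1 : R)) ∈ gr R m := ⟨1, rfl⟩
  let := (alg R p).graded
  unfold DGAlg.even
  simp only [LinearMap.comp_apply, LinearEquiv.coe_coe, DirectSum.decomposeLinearEquiv_apply]
  rw [DirectSum.decompose_of_mem (ℳ := (alg R p).gr) (i := m) hm]
  erw [DirectSum.toModule_lof]
  split_ifs <;> rfl

theorem odd_monomial (m : ℕ) : (alg R p).odd (Polynomial.monomial m 1) =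
    if Even m then 0 else Polynomial.monomial m 1 := by
  unfold DGAlg.odd
  rw [LinearMap.sub_apply, even_monomial]
  split_ifs <;> simp

theorem sgn_monomial (m : ℕ) : (alg R p).sgn (Polynomial.monomial m 1) =
    (-1 : R) ^ m • Polynomial.monomial m 1 := by
  unfold DGAlg.sgn
  rw [LinearMap.sub_apply, even_monomial, odd_monomial]
  split_ifs with h
  · simp [h.neg_one_pow]
  · rw [(Nat.not_even_iff_odd.1 h).neg_one_pow]; simp

theorem rot_mon (n : ℕ) (e : ℕ → ℕ) : (alg R p).rot n (mon R n e) =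
    (-1 : R) ^ (e n * tot n e) • mon R n (push (e n) e) := by
  unfold DGAlg.rot
  have hrot : ∀ (c : Fin (n + 1) → R), reindex R (fun _ => R[X]) (finRotate (n + 1))
      (tprod R fun i : Fin (n + 1) => c i • Polynomial.monomial (e i) (1 : R)) =
      (∏ i, c i) • mon R n (push (e n) e) := by
    intro c
    rw [MultilinearMap.map_smul_univ, map_smul, reindex_tprod]
    congr 1
    unfold mon
    congr 1
    funext i
    refine Fin.cases ?_ (fun k => ?_) i
    · have : (finRotate (n + 1)).symm 0 = Fin.last n := by
        rw [Equiv.symm_apply_eq, finRotate_last]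
      rw [this]; simp [push]
    · have : (finRotate (n + 1)).symm k.succ = k.castSucc := by
        rw [Equiv.symm_apply_eq, finRotate_apply]; simp
      rw [this]; simp [push]
  rw [LinearMap.comp_apply, LinearMap.add_apply, map_add, LinearEquiv.coe_coe]
  have h1 : PiTensorProduct.map (fun i => if i = Fin.last n then (alg R p).even else LinearMap.id)
      (mon R n e) = tprod R fun i : Fin (n + 1) =>
        (if i = Fin.last n then (if Even (e n) then (1 : R) else 0) else 1) •
          Polynomial.monomial (e i) (1 : R) := by
    unfold mon
    rw [map_tprod]
    congr 1
    funext i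
    by_cases hi : i = Fin.last n
    · subst hi
      simp only [if_true, even_monomial, Fin.val_last]
      split_ifs <;> simp
    · simp [hi]
  have h2 : PiTensorProduct.map (fun i => if i = Fin.last n then (alg R p).odd else (alg R p).sgn)
      (mon R n e) = tprod R fun i : Fin (n + 1) =>
        (if i = Fin.last n then (if Even (e n) then (0 : R) else 1) else (-1) ^ (e i)) •
          Polynomial.monomial (e i) (1 : R) := by
    unfold mon
    rw [map_tprod]
    congr 1
    funext i
    by_cases hi : i = Fin.last n
    · subst hi
      simp only [if_true, odd_monomial, Fin.val_last]
      split_ifs <;> simp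
    · simp [hi, sgn_monomial]
  rw [h1, h2, hrot, hrot, ← add_smul]
  congr 1
  rw [Fin.prod_univ_castSucc, Fin.prod_univ_castSucc]
  have hne : ∀ i : Fin n, i.castSucc ≠ Fin.last n := fun i => (Fin.castSucc_lt_last i).ne
  simp only [hne, if_false, if_true, Finset.prod_const_one, one_mul, Fin.val_castSucc]
  rw [Finset.prod_pow_eq_pow_sum, Fin.sum_univ_eq_sum_range (fun i => e i)]
  rcases Nat.even_or_odd (e n) with h | h
  · simp [h, (h.mul_right _).neg_one_pow]
  · rw [if_neg (Nat.not_even_iff_odd.2 h), if_neg (Nat.not_even_iff_odd.2 h), pow_mul,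
      h.neg_one_pow]
    simp [tot]

/-- The exponents after the `i`-th one has been lowered by one. -/
def lower (i : ℕ) (e : ℕ → ℕ) (k : ℕ) : ℕ := if k = i then e k - 1 else e k

/-- `1` for odd `m` and `0` for even `m`: the coefficient of `p x^(m-1)` in `δ(x^m)`. -/
def parity (m : ℕ) : R := if Odd m then 1 else 0

theorem inner_mon (n : ℕ) (e : ℕ → ℕ) : (alg R p).inner n (mon R n e) =
    (p : R) • ∑ i ∈ Finset.range (n + 1),
      ((-1 : R) ^ tot i e * parity R (e i)) • mon R n (lower i e) := by
  unfold DGAlg.inner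
  rw [LinearMap.sum_apply, Finset.smul_sum, ← Fin.sum_univ_eq_sum_range
    (fun i => (p : R) • ((-1 : R) ^ tot i e * parity R (e i)) • mon R n (lower i e))]
  refine Finset.sum_congr rfl fun i _ => ?_
  have h1 : PiTensorProduct.map (fun j => if j < i then (alg R p).sgn
      else if j = i then (alg R p).d else LinearMap.id) (mon R n e) =
      tprod R fun j : Fin (n + 1) =>
        (if j < i then (-1 : R) ^ (e j) else if j = i then p * parity R (e i) else 1) •
          Polynomial.monomial (lower i e j) (1 : R) := by
    unfold mon
    rw [map_tprod]
    congr 1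
    funext j
    rcases lt_trichotomy j i with h | h | h
    · have : (j : ℕ) ≠ i := by omega
      simp [h, sgn_monomial, lower, this]
    · subst h
      simp only [lt_irrefl, if_false, if_true, lower]
      change delta R p _ = _
      rw [delta_monomial]
      unfold parity
      split_ifs <;> simp
    · have : (j : ℕ) ≠ i := by omega
      simp [h.not_gt, h.ne', lower, this]
  rw [h1, MultilinearMap.map_smul_univ, smul_smul]
  congr 1
  have h2 : ∀ m < n + 1, ∏ k ∈ Finset.range (n + 1), (if k < m then (-1 : R) ^ (e k) else
      if k = m then p * parity R (e m) else 1) = p * ((-1 : R) ^ tot m e * parity R (e m)) := by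
    intro m hm
    obtain ⟨l, rfl⟩ : ∃ l, n = m + l := ⟨n - m, by omega⟩
    rw [show m + l + 1 = m + 1 + l by ring, Finset.prod_range_add, Finset.prod_range_succ,
      Finset.prod_congr (g := fun k => (-1 : R) ^ e k) rfl fun k hk => by
        simp [Finset.mem_range.1 hk], Finset.prod_pow_eq_pow_sum,
      Finset.prod_eq_one (s := Finset.range l) fun k _ => by
        have h3 : ¬ (m + 1 + k < m) := by omega
        have h4 : ¬ (m + 1 + k = m) := by omega
        simp only [h3, h4, if_false]]
    simp only [lt_irrefl, if_false, if_true, tot]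
    ring
  rw [← h2 i i.2, ← Fin.prod_univ_eq_prod_range (fun k : ℕ => if k < (i : ℕ) then
    (-1 : R) ^ (e k) else if k = (i : ℕ) then p * parity R (e i) else 1) (n + 1)]
  simp [Fin.ext_iff]

end Monomials

end KillP

/-! ### Simplicial and cyclic identities -/

namespace KillP

section Sums

variable {M : Type*} [AddCommGroup M]

theorem sum_antisymm_eq_zero (n : ℕ) (f : ℕ → ℕ → M) (h0 : ∀ i, f i i = 0)
    (h : ∀ i j, i < j → f i j + f j i = 0) :
    ∑ i ∈ Finset.range n, ∑ j ∈ Finset.range n, f i j = 0 := by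
  induction n with
  | zero => simp
  | succ n ih =>
    rw [Finset.sum_range_succ, Finset.sum_congr rfl fun i _ => Finset.sum_range_succ (f i) n,
      Finset.sum_add_distrib, ih, Finset.sum_range_succ, h0, zero_add, add_zero,
      ← Finset.sum_add_distrib]
    exact Finset.sum_eq_zero fun i hi => h i n (Finset.mem_range.1 hi)

/-- The cancellation behind `b ∘ b = 0`: the terms `(i, j)` with `i < j` are paired with the terms
`(j - 1, i)`. -/
theorem sum_simplicial_eq_zero (n : ℕ) (f : ℕ → ℕ → M)
    (h : ∀ i j, i < j → j ≤ n → f i j + f (j - 1) i = 0) :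
    ∑ i ∈ Finset.range n, ∑ j ∈ Finset.range (n + 1), f i j = 0 := by
  rw [← Finset.sum_product']
  refine Finset.sum_involution (fun x _ => if x.1 < x.2 then (x.2 - 1, x.1) else (x.2, x.1 + 1))
    ?_ ?_ ?_ ?_
  · rintro ⟨i, j⟩ hij
    simp only [Finset.mem_product, Finset.mem_range] at hij
    dsimp only
    split_ifs with h'
    · exact h i j h' (by omega)
    · have := h j (i + 1) (by omega) (by omega)
      rw [add_comm]
      simpa using this
  · rintro ⟨i, j⟩ _ _
    dsimp only
    split_ifs <;> simp only [ne_eq, Prod.mk.injEq] <;> omega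
  · rintro ⟨i, j⟩ hij
    simp only [Finset.mem_product, Finset.mem_range] at hij ⊢
    split_ifs <;> constructor <;> dsimp only <;> omega
  · rintro ⟨i, j⟩ hij
    dsimp only
    by_cases h' : i < j
    · rw [if_pos h', if_neg (show ¬ j - 1 < i by omega)]
      simp only [Prod.mk.injEq, true_and]
      omega
    · rw [if_neg h', if_pos (show j < i + 1 by omega)]
      simp

end Sums

section Identities

variable (R : Type*) [CommRing R] (p : ℕ)

/-- The face maps `d_0, …, d_{n+1}` on chains of Hochschild degree `n + 1`, the last one being the
cyclic rotation followed by `d_0`. -/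
noncomputable def dface (n j : ℕ) : Hoch.Chain R R[X] (n + 1) →ₗ[R] Hoch.Chain R R[X] n :=
  if h : j < n + 1 then Hoch.face R R[X] ⟨j, h⟩ else Hoch.face R R[X] 0 ∘ₗ (alg R p).rot (n + 1)

variable {R}

theorem dface_mon {n j : ℕ} (h : j ≤ n) (e : ℕ → ℕ) :
    dface R p n j (mon R (n + 1) e) = mon R n (contract j e) := by
  rw [dface, dif_pos (Nat.lt_succ_of_le h), face_mon]

theorem dface_last_mon (n : ℕ) (e : ℕ → ℕ) : dface R p n (n + 1) (mon R (n + 1) e) =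
    (-1 : R) ^ (e (n + 1) * tot (n + 1) e) • mon R n (contract 0 (push (e (n + 1)) e)) := by
  rw [dface, dif_neg (lt_irrefl _), LinearMap.comp_apply, rot_mon, map_smul, face_mon]
  rfl

theorem b_eq_sum (n : ℕ) : (alg R p).b n =
    ∑ j ∈ Finset.range (n + 2), (-1 : R) ^ j • dface R p n j := by
  rw [Finset.sum_range_succ, ← Fin.sum_univ_eq_sum_range (fun j => (-1 : R) ^ j • dface R p n j)]
  rw [DGAlg.b]
  congr 1
  · exact Finset.sum_congr rfl fun j _ => by rw [dface, dif_pos j.2]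
  · rw [dface, dif_neg (lt_irrefl _)]

theorem contract_contract {i j : ℕ} (h : i < j) (e : ℕ → ℕ) :
    contract i (contract j e) = contract (j - 1) (contract i e) := by
  obtain ⟨j, rfl⟩ : ∃ l, j = l + 1 := ⟨j - 1, by omega⟩
  funext k
  unfold contract
  rcases lt_trichotomy k i with h1 | rfl | h1
  · simp [h1, show k < j + 1 by omega, show k < j by omega]
  · rcases Nat.lt_or_ge k j with h2 | h2
    · simp [show k < j + 1 by omega, h2]
    · obtain rfl : k = j := by omega
      simp [add_assoc]
  · rcases lt_trichotomy k j with h2 | rfl | h2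
    · simp [h1.not_gt, h1.ne', h2]
    · simp [h1.not_gt, h1.ne', show ¬ k + 1 < i by omega, show k + 1 ≠ i by omega]
    · simp [h1.not_gt, h1.ne', h2.not_gt, h2.ne', show ¬ k + 1 < i by omega, show k + 1 ≠ i by omega]

theorem dface_comp_dface (n : ℕ) {i j : ℕ} (h : i < j) (hj : j ≤ n + 2) :
    dface R p n i ∘ₗ dface R p (n + 1) j = dface R p n (j - 1) ∘ₗ dface R p (n + 1) i := by
  refine chain_ext fun e => ?_
  simp only [LinearMap.comp_apply]
  rw [dface_mon p (show i ≤ n + 1 by omega)]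
  rcases Nat.lt_or_ge j (n + 2) with hj' | hj'
  · rw [dface_mon p (by omega), dface_mon p (by omega), dface_mon p (by omega),
      contract_contract h]
  obtain rfl : j = n + 2 := by omega
  rw [dface_last_mon, map_smul, show n + 2 - 1 = n + 1 from rfl, dface_last_mon]
  rcases Nat.lt_or_ge i (n + 1) with hi | hi
  · rw [dface_mon p (by omega), tot_contract (by omega)]
    congr 1
    · simp [contract, show ¬ n + 1 < i by omega, show n + 1 ≠ i by omega]
    · refine mon_congr R fun k hk => ?_
      simp only [contract, push]
      grind
  · obtain rfl : i = n + 1 := by omega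
    rw [dface_last_mon, smul_smul, ← pow_add]
    congr 1
    · refine neg_one_pow_congr ?_
      rw [tot_contract_of_le le_rfl, tot_contract (by omega), tot_push]
      simp only [contract, push, tot_succ]
      simp [parity_simps]
      tauto
    · refine mon_congr R fun k hk => ?_
      simp only [contract, push]
      grind

theorem b_b (n : ℕ) : (alg R p).b n ∘ₗ (alg R p).b (n + 1) = 0 := by
  rw [b_eq_sum, b_eq_sum]
  refine LinearMap.ext fun x => ?_
  simp only [LinearMap.comp_apply, LinearMap.sum_apply, map_sum, LinearMap.zero_apply]
  rw [Finset.sum_comm]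
  refine sum_simplicial_eq_zero (n + 2) _ fun i j h hj => ?_
  have h1 := LinearMap.congr_fun (dface_comp_dface p n h hj) x
  simp only [LinearMap.comp_apply] at h1
  simp only [LinearMap.smul_apply, map_smul, h1, smul_smul, ← add_smul]
  obtain ⟨j, rfl⟩ : ∃ l, j = l + 1 := ⟨j - 1, by omega⟩
  rw [show j + 1 - 1 = j from rfl, ← pow_add, ← pow_add]
  convert zero_smul R _ using 2
  ring

theorem dface_comp_rot (n : ℕ) {j : ℕ} (hj : j ≤ n) :
    dface R p n (j + 1) ∘ₗ (alg R p).rot (n + 1) = (alg R p).rot n ∘ₗ dface R p n j := by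
  refine chain_ext fun e => ?_
  simp only [LinearMap.comp_apply]
  rw [rot_mon, dface_mon p hj, rot_mon, map_smul]
  rcases Nat.lt_or_ge j n with h | h
  · rw [dface_mon p h]
    congr 1
    · rw [tot_contract h]
      simp [contract, h.not_gt, h.ne']
    · refine mon_congr R fun k hk => ?_
      simp only [contract, push]
      grind
  · obtain rfl : j = n := by omega
    rw [dface_last_mon, smul_smul, ← pow_add]
    congr 1
    · refine neg_one_pow_congr ?_
      rw [tot_contract_of_le le_rfl, tot_push]
      simp only [contract, push, tot_succ]
      simp [parity_simps]
      tauto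
    · refine mon_congr R fun k hk => ?_
      simp only [contract, push]
      grind

/-- After `i` rotations, the last `i` factors have moved to the front. Moving a factor of degree `a`
across all the others contributes the sign exponent `a (t - a) ≡ a (t + 1)`, for the total degree
`t`. -/
theorem rot_pow_mon (n : ℕ) (i : ℕ) (hi : i ≤ n + 1) (e : ℕ → ℕ) :
    ((alg R p).rot n ^ i) (mon R n e) =
      (-1 : R) ^ ((∑ k ∈ Finset.range i, e (n - k)) * (tot (n + 1) e + 1)) •
        mon R n (fun k => if k < i then e (n + 1 - i + k) else e (k - i)) := by
  induction i generalizing e with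
  | zero => simp
  | succ i ih =>
    rw [pow_succ, Module.End.mul_apply, rot_mon, map_smul, ih (by omega), smul_smul, ← pow_add]
    congr 1
    · refine neg_one_pow_congr ?_
      rw [Finset.sum_range_succ', tot_push, tot_succ,
        Finset.sum_congr (g := fun k => e (n - (k + 1))) rfl fun k hk => by
          have := Finset.mem_range.1 hk
          rw [push, if_neg (by omega), Nat.sub_add_eq]]
      simp [parity_simps]
      tauto
    · refine mon_congr R fun k hk => ?_
      simp only [push]
      grind

theorem rot_pow (n : ℕ) : (alg R p).rot n ^ (n + 1) = 1 := by
  refine chain_ext fun e => ?_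
  have h : ∑ k ∈ Finset.range (n + 1), e (n - k) = tot (n + 1) e :=
    Finset.sum_range_reflect e (n + 1)
  rw [rot_pow_mon p n _ le_rfl, h, (Nat.even_mul_succ_self _).neg_one_pow, one_smul]
  refine mon_congr R fun k hk => ?_
  simp [Nat.lt_succ_of_le hk]

theorem dface_zero_comp_extra (n : ℕ) : dface R p n 0 ∘ₗ Hoch.extra R R[X] n = LinearMap.id := by
  refine chain_ext fun e => ?_
  rw [LinearMap.comp_apply, extra_mon, dface_mon p (by omega)]
  refine mon_congr R fun k hk => ?_
  simp only [contract, push]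
  grind

theorem dface_comp_extra (n : ℕ) {j : ℕ} (hj : j ≤ n) :
    dface R p (n + 1) (j + 1) ∘ₗ Hoch.extra R R[X] (n + 1) =
      Hoch.extra R R[X] n ∘ₗ dface R p n j := by
  refine chain_ext fun e => ?_
  simp only [LinearMap.comp_apply]
  rw [extra_mon, dface_mon p (by omega), dface_mon p hj, extra_mon]
  refine mon_congr R fun k hk => ?_
  simp only [contract, push]
  grind

end Identities
end KillP

/-! ### The inner differential -/

namespace KillP
section Identities
variable {R : Type*} [CommRing R] (p : ℕ)

theorem sum_range_split {M : Type*} [AddCommMonoid M] {N j d : ℕ} (h : N = j + 1 + d)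
    (f : ℕ → M) : ∑ i ∈ Finset.range N, f i =
      ∑ i ∈ Finset.range j, f i + f j + ∑ i ∈ Finset.range d, f (j + 1 + i) := by
  rw [h, Finset.sum_range_add, Finset.sum_range_succ]

theorem parity_add (a c : ℕ) :
    parity R (a + c) = parity R a + (-1 : R) ^ a * parity R c := by
  unfold parity
  rcases Nat.even_or_odd a with ha | ha <;> rcases Nat.even_or_odd c with hc | hc <;>
    simp [ha, hc, ha.neg_one_pow, parity_simps, Nat.not_odd_iff_even.2, Nat.not_even_iff_odd.2]

theorem odd_of_parity_ne_zero {a : ℕ} (h : parity R a ≠ 0) : Odd a := by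
  by_contra h'
  exact h (if_neg h')

theorem tot_lower_of_le {n i : ℕ} (h : n ≤ i) (e : ℕ → ℕ) : tot n (lower i e) = tot n e :=
  tot_congr fun k hk => by simp [lower, (lt_of_lt_of_le hk h).ne]

theorem tot_lower {n i : ℕ} (h : i < n) (e : ℕ → ℕ) (he : 0 < e i) :
    tot n (lower i e) + 1 = tot n e := by
  induction n with
  | zero => omega
  | succ n ih =>
    rw [tot_succ, tot_succ]
    rcases Nat.lt_or_ge i n with h' | h'
    · have := ih h'
      simp only [lower, h'.ne', if_false]
      omega
    · obtain rfl : i = n := by omega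
      rw [tot_lower_of_le le_rfl]
      simp only [lower, if_true]
      omega

/-- The differential of a tensor of monomials, divided by `p`. -/
noncomputable def derivMon (n : ℕ) (e : ℕ → ℕ) : Hoch.Chain R R[X] n :=
  ∑ i ∈ Finset.range (n + 1), ((-1 : R) ^ tot i e * parity R (e i)) • mon R n (lower i e)

theorem inner_mon' (n : ℕ) (e : ℕ → ℕ) :
    (alg R p).inner n (mon R n e) = (p : R) • derivMon n e := inner_mon R p n e

theorem dface_derivMon (n : ℕ) {j : ℕ} (hj : j ≤ n) (e : ℕ → ℕ) :
    dface R p n j (derivMon (n + 1) e) = derivMon n (contract j e) := by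
  obtain ⟨d, rfl⟩ : ∃ d, n = j + d := ⟨n - j, by omega⟩
  unfold derivMon
  -- the terms `j` and `j + 1` are matched with term `j` of the right-hand side by `parity_add`
  rw [map_sum, sum_range_split (show j + d + 1 + 1 = j + 1 + (d + 1) by ring),
    Finset.sum_range_succ', sum_range_split (show j + d + 1 = j + 1 + d by ring),
    add_comm (∑ i ∈ Finset.range d, _), ← add_assoc, add_assoc (∑ i ∈ Finset.range j, _)]
  simp only [map_smul, dface_mon p hj]
  congr 1
  · congr 1
    · refine Finset.sum_congr rfl fun i hi => ?_
      have hi' := Finset.mem_range.1 hi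
      rw [tot_contract_of_le hi'.le]
      congr 1
      · simp [contract, hi']
      · refine mon_congr R fun k hk => ?_
        simp only [contract, lower]
        grind
    · have h1 : parity R (e j) • mon R (j + d) (contract j (lower j e)) =
          parity R (e j) • mon R (j + d) (lower j (contract j e)) := by
        by_cases h : parity R (e j) = 0
        · rw [h, zero_smul, zero_smul]
        have := (odd_of_parity_ne_zero h).pos
        congr 1
        refine mon_congr R fun k hk => ?_
        simp only [contract, lower]
        grind
      have h2 : parity R (e (j + 1)) • mon R (j + d) (contract j (lower (j + 1) e)) =
          parity R (e (j + 1)) • mon R (j + d) (lower j (contract j e)) := by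
        by_cases h : parity R (e (j + 1)) = 0
        · rw [h, zero_smul, zero_smul]
        have := (odd_of_parity_ne_zero h).pos
        congr 1
        refine mon_congr R fun k hk => ?_
        simp only [contract, lower]
        grind
      have h3 : contract j e j = e j + e (j + 1) := by simp [contract]
      rw [add_zero, mul_smul, h1, mul_smul, h2, h3, tot_contract_of_le le_rfl, parity_add, tot_succ,
        pow_add, smul_smul, smul_smul, ← add_smul]
      congr 1
      ring
  · refine Finset.sum_congr rfl fun i hi => ?_
    rw [tot_contract (by omega)]
    congr 1
    · rw [show j + 1 + (i + 1) = j + 1 + i + 1 by ring]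
      simp [contract, show ¬ j + 1 + i < j by omega, show j + 1 + i ≠ j by omega]
    · refine mon_congr R fun k hk => ?_
      simp only [contract, lower]
      grind

theorem rot_derivMon (n : ℕ) (e : ℕ → ℕ) : (alg R p).rot n (derivMon n e) =
    (-1 : R) ^ (e n * tot n e) • derivMon n (push (e n) e) := by
  unfold derivMon
  rw [map_sum, Finset.sum_range_succ, Finset.sum_range_succ' _ n, smul_add, Finset.smul_sum]
  simp only [map_smul, rot_mon]
  congr 1
  · refine Finset.sum_congr rfl fun i hi => ?_
    have hi' := Finset.mem_range.1 hi
    have h0 : push (e n) e (i + 1) = e i := by simp [push]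
    rw [tot_push, h0, smul_smul, smul_smul]
    by_cases h : parity R (e i) = 0
    · simp [h]
    have ho := odd_of_parity_ne_zero h
    congr 1
    · have h1 : lower i e n = e n := by simp [lower, hi'.ne']
      have h2 := tot_lower hi' e ho.pos
      rw [mul_right_comm, ← mul_assoc, ← pow_add, ← pow_add, h1, ← h2]
      congr 1
      refine neg_one_pow_congr ?_
      simp only [← Nat.not_even_iff_odd, Nat.even_add, Nat.even_mul, Nat.not_even_one] at *
      tauto
    · refine mon_congr R fun k hk => ?_
      simp only [push, lower]
      grind
  · have h0 : push (e n) e 0 = e n := by simp [push]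
    rw [h0, smul_smul, smul_smul, tot_lower_of_le le_rfl]
    by_cases h : parity R (e n) = 0
    · simp [h]
    have ho := odd_of_parity_ne_zero h
    congr 1
    · have h1 : lower n e n + 1 = e n := by have := ho.pos; simp [lower]; omega
      rw [mul_right_comm, ← mul_assoc, ← pow_add, ← pow_add, ← h1]
      congr 1
      refine neg_one_pow_congr ?_
      rw [← h1] at ho
      simp only [← Nat.not_even_iff_odd, Nat.even_add, Nat.even_mul, Nat.not_even_one] at *
      tauto
    · refine mon_congr R fun k hk => ?_
      simp only [push, lower]
      grind

theorem extra_derivMon (n : ℕ) (e : ℕ → ℕ) :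
    Hoch.extra R R[X] n (derivMon n e) = derivMon (n + 1) (push 0 e) := by
  unfold derivMon
  rw [map_sum, Finset.sum_range_succ' _ (n + 1)]
  have h0 : parity R (push 0 e 0) = 0 := by simp [parity, push]
  rw [h0, mul_zero, zero_smul, add_zero]
  refine Finset.sum_congr rfl fun i hi => ?_
  have h0 : push 0 e (i + 1) = e i := by simp [push]
  rw [map_smul, extra_mon, tot_push, h0, zero_add]
  congr 1
  refine mon_congr R fun k hk => ?_
  simp only [push, lower]
  grind

theorem dface_comp_inner (n : ℕ) {j : ℕ} (hj : j ≤ n) :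
    dface R p n j ∘ₗ (alg R p).inner (n + 1) = (alg R p).inner n ∘ₗ dface R p n j := by
  refine chain_ext fun e => ?_
  rw [LinearMap.comp_apply, LinearMap.comp_apply, inner_mon', map_smul, dface_derivMon p n hj,
    dface_mon p hj, inner_mon']

theorem rot_comp_inner (n : ℕ) :
    (alg R p).rot n ∘ₗ (alg R p).inner n = (alg R p).inner n ∘ₗ (alg R p).rot n := by
  refine chain_ext fun e => ?_
  rw [LinearMap.comp_apply, LinearMap.comp_apply, inner_mon', map_smul, rot_derivMon,
    rot_mon, map_smul, inner_mon', smul_comm]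

theorem extra_comp_inner (n : ℕ) : Hoch.extra R R[X] n ∘ₗ (alg R p).inner n =
    (alg R p).inner (n + 1) ∘ₗ Hoch.extra R R[X] n := by
  refine chain_ext fun e => ?_
  rw [LinearMap.comp_apply, LinearMap.comp_apply, inner_mon', map_smul, extra_derivMon,
    extra_mon, inner_mon']

/-- The terms of `inner ∘ inner` that lower the `i`-th and the `j`-th exponent in either order have
opposite signs. -/
theorem inner_inner (n : ℕ) : (alg R p).inner n ∘ₗ (alg R p).inner n = 0 := by
  refine chain_ext fun e => ?_
  rw [LinearMap.comp_apply, inner_mon', map_smul, derivMon, map_sum, LinearMap.zero_apply]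
  simp only [map_smul, inner_mon']
  rw [Finset.sum_congr rfl fun i _ => smul_comm _ (p : R) _, ← Finset.smul_sum]
  unfold derivMon
  simp only [Finset.smul_sum (r := (_ * _ : R)), smul_smul (_ * _ : R)]
  rw [sum_antisymm_eq_zero, smul_zero, smul_zero]
  · intro i
    by_cases h : parity R (e i) = 0
    · simp [h]
    have ho := odd_of_parity_ne_zero h
    have h1 : parity R (lower i e i) = 0 := by
      refine if_neg ?_
      simp only [lower, if_true]
      rw [Nat.not_odd_iff_even]
      exact Nat.Odd.sub_odd ho odd_one
    simp [h1]
  · intro i j hij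
    have h1 : lower i e j = e j := by simp [lower, hij.ne']
    have h2 : lower j e i = e i := by simp [lower, hij.ne]
    rw [h1, h2, tot_lower_of_le hij.le]
    by_cases h : parity R (e i) = 0
    · simp [h]
    have ho := odd_of_parity_ne_zero h
    rw [← tot_lower hij e ho.pos]
    have h3 : lower j (lower i e) = lower i (lower j e) := by
      funext k
      simp only [lower]
      grind
    rw [h3, ← add_smul]
    convert zero_smul R _ using 2
    ring

end Identities
end KillP

/-! ### The total differential squares to zero -/

namespace KillP
section Identities
variable {R : Type*} [CommRing R] (p : ℕ)

local notation "Ch" => Hoch.Chain R R[X]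

theorem dface_last (n : ℕ) :
    dface R p n (n + 1) = dface R p n 0 ∘ₗ (alg R p).rot (n + 1) := by
  rw [dface, dif_neg (lt_irrefl _), dface, dif_pos (Nat.succ_pos n)]
  rfl

theorem b_inner (n : ℕ) :
    (alg R p).b n ∘ₗ (alg R p).inner (n + 1) = (alg R p).inner n ∘ₗ (alg R p).b n := by
  have h : ∀ j ≤ n + 1,
      dface R p n j ∘ₗ (alg R p).inner (n + 1) = (alg R p).inner n ∘ₗ dface R p n j := by
    intro j hj
    rcases Nat.lt_or_ge j (n + 1) with hj' | hj'
    · exact dface_comp_inner p n (by omega)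
    · obtain rfl : j = n + 1 := by omega
      rw [dface_last, LinearMap.comp_assoc, rot_comp_inner, ← LinearMap.comp_assoc,
        dface_comp_inner p n (by omega), LinearMap.comp_assoc]
  rw [b_eq_sum]
  refine LinearMap.ext fun x => ?_
  simp only [LinearMap.comp_apply, LinearMap.sum_apply, map_sum, LinearMap.smul_apply, map_smul]
  refine Finset.sum_congr rfl fun j hj => ?_
  have := LinearMap.congr_fun (h j (by have := Finset.mem_range.1 hj; omega)) x
  rw [LinearMap.comp_apply, LinearMap.comp_apply] at this
  rw [this]

theorem cyc_pow_comp_inner (n i : ℕ) (x : Ch n) :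
    ((alg R p).cyc n ^ i) ((alg R p).inner n x) = (alg R p).inner n (((alg R p).cyc n ^ i) x) := by
  have h : ∀ y, (alg R p).cyc n ((alg R p).inner n y) = (alg R p).inner n ((alg R p).cyc n y) := by
    intro y
    have := LinearMap.congr_fun (rot_comp_inner (R := R) p n) y
    rw [LinearMap.comp_apply, LinearMap.comp_apply] at this
    rw [DGAlg.cyc, LinearMap.smul_apply, LinearMap.smul_apply, map_smul, this]
  induction i with
  | zero => rfl
  | succ i ih => rw [pow_succ', Module.End.mul_apply, Module.End.mul_apply, ih, h]

theorem connes_inner (n : ℕ) : (alg R p).connes n ∘ₗ (alg R p).inner n =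
    (alg R p).inner (n + 1) ∘ₗ (alg R p).connes n := by
  refine LinearMap.ext fun x => ?_
  have h1 : (alg R p).norm n ((alg R p).inner n x) = (alg R p).inner n ((alg R p).norm n x) := by
    simp only [DGAlg.norm, LinearMap.sum_apply, map_sum, cyc_pow_comp_inner]
  have h2 := LinearMap.congr_fun (extra_comp_inner (R := R) p n) ((alg R p).norm n x)
  have h3 := cyc_pow_comp_inner p (n + 1) 1 (Hoch.extra R R[X] n ((alg R p).norm n x))
  simp only [LinearMap.comp_apply, pow_one] at h2 h3
  simp only [DGAlg.connes, LinearMap.comp_apply, LinearMap.sub_apply, LinearMap.id_apply, h1, h2,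
    h3, map_sub]

theorem cyc_pow (n : ℕ) : (alg R p).cyc n ^ (n + 1) = 1 := by
  rw [DGAlg.cyc, smul_pow, rot_pow, ← pow_mul, (Nat.even_mul_succ_self n).neg_one_pow, one_smul]

theorem norm_comp (n : ℕ) (x : Ch n) :
    (alg R p).norm n (x - (alg R p).cyc n x) = 0 := by
  have h : (alg R p).norm n * (1 - (alg R p).cyc n) = 0 := by
    rw [DGAlg.norm, mul_one_sub, Finset.sum_mul]
    simp only [← pow_succ]
    rw [← Finset.sum_sub_distrib, Finset.sum_range_sub', cyc_pow, pow_zero, sub_self]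
  exact LinearMap.congr_fun h x

theorem comp_norm (n : ℕ) (x : Ch n) :
    (alg R p).cyc n ((alg R p).norm n x) = (alg R p).norm n x := by
  have h : (1 - (alg R p).cyc n) * (alg R p).norm n = 0 := by
    rw [DGAlg.norm, one_sub_mul, Finset.mul_sum]
    simp only [← pow_succ']
    rw [← Finset.sum_sub_distrib, Finset.sum_range_sub', cyc_pow, pow_zero, sub_self]
  exact (sub_eq_zero.1 (LinearMap.congr_fun h x)).symm

theorem connes_connes (n : ℕ) : (alg R p).connes (n + 1) ∘ₗ (alg R p).connes n = 0 := by
  refine LinearMap.ext fun x => ?_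
  rw [LinearMap.comp_apply, DGAlg.connes, DGAlg.connes]
  simp only [LinearMap.comp_apply, LinearMap.sub_apply, LinearMap.id_apply, norm_comp, map_zero,
    LinearMap.zero_apply]

/-- The signed face map `(-1)^j d_j`. -/
noncomputable def sface (n j : ℕ) : Ch (n + 1) →ₗ[R] Ch n := (-1 : R) ^ j • dface R p n j

/-- The bar differential `b' = ∑_{j ≤ n} (-1)^j d_j`, which omits the last face. -/
noncomputable def bar (n : ℕ) : Ch (n + 1) →ₗ[R] Ch n := ∑ j ∈ Finset.range (n + 1), sface p n j

theorem b_eq_sface (n : ℕ) : (alg R p).b n = ∑ j ∈ Finset.range (n + 2), sface p n j :=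
  b_eq_sum p n

theorem sface_cyc (n : ℕ) {j : ℕ} (hj : j ≤ n) (x : Ch (n + 1)) :
    sface p n (j + 1) ((alg R p).cyc (n + 1) x) = (alg R p).cyc n (sface p n j x) := by
  have := LinearMap.congr_fun (dface_comp_rot (R := R) p n hj) x
  rw [LinearMap.comp_apply, LinearMap.comp_apply] at this
  simp only [sface, DGAlg.cyc, LinearMap.smul_apply, map_smul, this, smul_smul, ← pow_add]
  congr 1
  exact neg_one_pow_congr (by simp only [Nat.even_add, Nat.not_even_one]; tauto)

theorem sface_zero_cyc (n : ℕ) (x : Ch (n + 1)) :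
    sface p n 0 ((alg R p).cyc (n + 1) x) = sface p n (n + 1) x := by
  simp only [sface, DGAlg.cyc, LinearMap.smul_apply, map_smul, dface_last, pow_zero, one_smul,
    LinearMap.comp_apply]

/-- The relation `b (1 - t) = (1 - t) b'`. -/
theorem b_sub_cyc (n : ℕ) (x : Ch (n + 1)) :
    (alg R p).b n (x - (alg R p).cyc (n + 1) x) = bar p n x - (alg R p).cyc n (bar p n x) := by
  have h : (alg R p).b n ((alg R p).cyc (n + 1) x) =
      (alg R p).cyc n (bar p n x) + sface p n (n + 1) x := by
    rw [b_eq_sface, LinearMap.sum_apply, Finset.sum_range_succ', sface_zero_cyc, bar,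
      LinearMap.sum_apply, map_sum]
    congr 1
    refine Finset.sum_congr rfl fun j hj => sface_cyc p n ?_ x
    have := Finset.mem_range.1 hj
    omega
  rw [map_sub, h, b_eq_sface, LinearMap.sum_apply, Finset.sum_range_succ, bar, LinearMap.sum_apply]
  abel

theorem sface_cyc_pow (n i : ℕ) : ∀ j, i + j ≤ n + 1 → ∀ x : Ch (n + 1),
    sface p n (i + j) (((alg R p).cyc (n + 1) ^ i) x) = ((alg R p).cyc n ^ i) (sface p n j x) := by
  induction i with
  | zero => intro j _ x; rw [zero_add]; rfl
  | succ i ih =>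
    intro j hj x
    rw [pow_succ', Module.End.mul_apply, add_right_comm i 1 j, sface_cyc p n (by omega),
      ih j (by omega), pow_succ', Module.End.mul_apply]

theorem sface_cyc_pow' (n j i : ℕ) (hi : i ≤ n) (hj : j ≤ n) (x : Ch (n + 1)) :
    sface p n j (((alg R p).cyc (n + 1) ^ (j + i + 1)) x) =
      ((alg R p).cyc n ^ (j + i)) (sface p n (n + 1 - i) x) := by
  have h1 := sface_cyc_pow p n j 0 (by omega) (((alg R p).cyc (n + 1) ^ (i + 1)) x)
  have h2 := sface_cyc_pow p n i (n + 1 - i) (by omega) x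
  rw [add_zero] at h1
  rw [add_assoc j i 1, pow_add, Module.End.mul_apply, h1, pow_succ', Module.End.mul_apply, sface_zero_cyc,
    pow_add, Module.End.mul_apply, ← h2, Nat.add_sub_cancel' (show i ≤ n + 1 by omega)]

/-- The relation `b' N = N b`: both sides are the sum of all `tⁱ (-1)^j d_j`, because `(-1)^j d_j tⁱ`
is `tⁱ (-1)^(j-i) d_(j-i)` for `i ≤ j`, and wraps around through the last face for `i > j`. -/
theorem bar_norm (n : ℕ) (x : Ch (n + 1)) :
    bar p n ((alg R p).norm (n + 1) x) = (alg R p).norm n ((alg R p).b n x) := by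
  rw [bar, DGAlg.norm, DGAlg.norm, b_eq_sface]
  simp only [LinearMap.sum_apply, map_sum]
  rw [Finset.sum_comm (s := Finset.range (n + 2)), ← Finset.sum_product', ← Finset.sum_product']
  refine Finset.sum_nbij'
    (fun z => if z.2 ≤ z.1 then (z.1 - z.2, z.2) else (n + 2 + z.1 - z.2, z.2 - 1))
    (fun z => if z.2 + z.1 ≤ n then (z.2 + z.1, z.2) else (z.1 + z.2 - n - 1, z.2 + 1))
    ?_ ?_ ?_ ?_ ?_
  all_goals
    rintro ⟨i, j⟩ h
    simp only [Finset.mem_product, Finset.mem_range] at h ⊢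
  · split_ifs <;> constructor <;> dsimp only <;> omega
  · split_ifs <;> constructor <;> dsimp only <;> omega
  · by_cases h' : j ≤ i
    · rw [if_pos h', if_pos (by dsimp only; omega)]
      refine Prod.ext ?_ ?_ <;> dsimp only <;> omega
    · rw [if_neg h', if_neg (by dsimp only; omega)]
      refine Prod.ext ?_ ?_ <;> dsimp only <;> omega
  · by_cases h' : j + i ≤ n
    · rw [if_pos h', if_pos (by dsimp only; omega)]
      refine Prod.ext ?_ ?_ <;> dsimp only <;> omega
    · rw [if_neg h', if_neg (by dsimp only; omega)]
      refine Prod.ext ?_ ?_ <;> dsimp only <;> omega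
  · split_ifs with h'
    · have := sface_cyc_pow p n j (i - j) (by omega) x
      rwa [Nat.add_sub_cancel' h'] at this
    · have := sface_cyc_pow' p n i (j - i - 1) (by omega) (by omega) x
      dsimp only
      rwa [show i + (j - i - 1) + 1 = j by omega, show i + (j - i - 1) = j - 1 by omega,
        show n + 1 - (j - i - 1) = n + 2 + i - j by omega] at this

/-- The relation `b' s + s b' = 1`. -/
theorem bar_extra (n : ℕ) (x : Ch (n + 1)) : bar p (n + 1) (Hoch.extra R R[X] (n + 1) x) =
    x - Hoch.extra R R[X] n (bar p n x) := by
  rw [bar, LinearMap.sum_apply, Finset.sum_range_succ', bar, LinearMap.sum_apply, map_sum,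
    sub_eq_neg_add, ← Finset.sum_neg_distrib]
  congr 1
  · refine Finset.sum_congr rfl fun j hj => ?_
    have := LinearMap.congr_fun (dface_comp_extra (R := R) p n (j := j)
      (by have := Finset.mem_range.1 hj; omega)) x
    rw [LinearMap.comp_apply, LinearMap.comp_apply] at this
    rw [sface, sface, LinearMap.smul_apply, LinearMap.smul_apply, this, map_smul, pow_succ]
    simp
  · rw [sface, pow_zero, one_smul]
    exact LinearMap.congr_fun (dface_zero_comp_extra (R := R) p (n + 1)) x

theorem b_connes_zero : (alg R p).b 0 ∘ₗ (alg R p).connes 0 = 0 := by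
  refine LinearMap.ext fun x => ?_
  have h1 : (alg R p).cyc 0 = LinearMap.id := by
    simpa [Module.End.one_eq_id] using cyc_pow (R := R) p 0
  rw [LinearMap.comp_apply, DGAlg.connes, LinearMap.comp_apply, LinearMap.sub_apply,
    LinearMap.id_apply, b_sub_cyc, h1, LinearMap.id_apply, sub_self, LinearMap.zero_apply]

theorem b_connes (n : ℕ) : (alg R p).b (n + 1) ∘ₗ (alg R p).connes (n + 1) +
    (alg R p).connes n ∘ₗ (alg R p).b n = 0 := by
  refine LinearMap.ext fun x => ?_
  simp only [DGAlg.connes, LinearMap.add_apply, LinearMap.comp_apply, LinearMap.sub_apply,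
    LinearMap.id_apply, b_sub_cyc, bar_extra, bar_norm, LinearMap.zero_apply]
  simp only [map_sub, comp_norm]
  abel

theorem totD_apply_zero (f : (alg R p).Tot) (k : ℕ) :
    (alg R p).totD f k 0 = (alg R p).b 0 (f k 1) + (alg R p).inner 0 (f k 0) := by
  simp [DGAlg.totD, DGAlg.totConnes]

theorem totD_apply_succ (f : (alg R p).Tot) (k n : ℕ) :
    (alg R p).totD f k (n + 1) = (alg R p).b (n + 1) (f k (n + 2)) +
      (-1 : R) ^ (n + 1) • (alg R p).inner (n + 1) (f k (n + 1)) +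
      (alg R p).connes n (f (k + 1) n) := by
  simp [DGAlg.totD, DGAlg.totConnes]

theorem totD_totD (f : (alg R p).Tot) : (alg R p).totD ((alg R p).totD f) = 0 := by
  have hbb := fun n x => LinearMap.congr_fun (b_b (R := R) p n) x
  have hbi := fun n x => LinearMap.congr_fun (b_inner (R := R) p n) x
  have hii := fun n x => LinearMap.congr_fun (inner_inner (R := R) p n) x
  have hci := fun n x => LinearMap.congr_fun (connes_inner (R := R) p n) x
  have hcc := fun n x => LinearMap.congr_fun (connes_connes (R := R) p n) x
  have hbc := fun n x => eq_neg_of_add_eq_zero_left (LinearMap.congr_fun (b_connes (R := R) p n) x)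
  have hbc0 := fun x => LinearMap.congr_fun (b_connes_zero (R := R) p) x
  simp only [LinearMap.comp_apply, LinearMap.zero_apply] at hbb hbi hii hci hcc hbc hbc0
  funext k n
  rcases n with _ | n
  · rw [totD_apply_zero, totD_apply_zero, totD_apply_succ]
    simp [hbb, hbi, hii, hbc0]
  · rw [totD_apply_succ, totD_apply_succ, totD_apply_succ]
    rcases n with _ | n
    · rw [totD_apply_zero]
      simp [hbb, hbi, hii, hci, hbc, pow_succ]
      abel
    · rw [totD_apply_succ]
      rcases neg_one_pow_eq_or R n with h | h <;>
      · simp [hbb, hbi, hii, hci, hcc, hbc, pow_succ, h]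
        abel

end Identities
end KillP

/-! ### Contracting the Hochschild complex -/

namespace KillP
section Homotopy
variable {R : Type*} [CommRing R] (p : ℕ)

local notation "Ch" => Hoch.Chain R R[X]

/-- The exponents of `x^(c + e 0) ⊗ x^(e 1) ⊗ ⋯ ⊗ x^(e (n-1)) ⊗ x^i ⊗ x^l`. -/
def insExp (n c i l : ℕ) (e : ℕ → ℕ) (k : ℕ) : ℕ :=
  (if k < n then e k else if k = n then i else l) + if k = 0 then c else 0

/-- The result of moving `x^c` from the end of `x^(e 0) ⊗ ⋯ ⊗ x^(e (n-1)) ⊗ x^i ⊗ x^l` to its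
front, with the Koszul sign. -/
noncomputable def insTwo (n c i l : ℕ) (e : ℕ → ℕ) : Ch (n + 1) :=
  (-1 : R) ^ (c * (tot n e + i + l)) • mon R (n + 1) (insExp n c i l e)

/-- The result of moving `x^c` from the end of `x^(e 0) ⊗ ⋯ ⊗ x^(e (n-1)) ⊗ x^i` to its front, with
the Koszul sign. -/
noncomputable def insOne (n c i : ℕ) (e : ℕ → ℕ) : Ch n :=
  (-1 : R) ^ (c * (tot n e + i)) • mon R n (insExp n c i 0 e)

theorem insTwo_congr {n : ℕ} {e e' : ℕ → ℕ} (h : ∀ i < n, e i = e' i) (c i l : ℕ) :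
    insTwo (R := R) n c i l e = insTwo n c i l e' := by
  rw [insTwo, insTwo, tot_congr h]
  congr 1
  refine mon_congr R fun k hk => ?_
  simp only [insExp]
  grind

variable (R) in
/-- The homotopy `a₀ ⊗ ⋯ ⊗ aₙ₋₁ ⊗ x^e ↦ ∑_{i < e} ± x^(e-1-i) a₀ ⊗ ⋯ ⊗ aₙ₋₁ ⊗ x^i ⊗ x`, from which
`± x^e a₀ ⊗ ⋯ ⊗ aₙ₋₁ ⊗ 1 ⊗ 1` is subtracted because the chains are not normalized. It
contracts the Hochschild complex in degrees at least two. -/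
noncomputable def htpy (n : ℕ) : Ch n →ₗ[R] Ch (n + 1) :=
  ofMon n fun e => ∑ i ∈ Finset.range (e n), insTwo n (e n - 1 - i) i 1 e - insTwo n (e n) 0 0 e

theorem htpy_mon (n : ℕ) (e : ℕ → ℕ) : htpy R n (mon R n e) =
    ∑ i ∈ Finset.range (e n), insTwo n (e n - 1 - i) i 1 e - insTwo n (e n) 0 0 e := by
  refine ofMon_mon (fun e e' h => ?_) e
  rw [h n le_rfl, insTwo_congr fun i hi => h i hi.le]
  congr 1
  exact Finset.sum_congr rfl fun i _ => insTwo_congr (fun i hi => h i hi.le) _ _ _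

-- The faces of `insTwo`: within the leading factors, at the two inserted factors, and the last one.

theorem dface_insTwo_of_lt {n j : ℕ} (h : j ≤ n) (c i l : ℕ) (e : ℕ → ℕ) :
    dface R p (n + 2) j (insTwo (n + 2) c i l e) = insTwo (n + 1) c i l (contract j e) := by
  rw [insTwo, insTwo, map_smul, dface_mon p (by omega), tot_contract (by omega)]
  congr 1
  refine mon_congr R fun k hk => ?_
  simp only [insExp, contract]
  grind

theorem dface_insTwo_pred (n c i l : ℕ) (e : ℕ → ℕ) :
    dface R p (n + 2) (n + 1) (insTwo (n + 2) c i l e) = insTwo (n + 1) c (e (n + 1) + i) l e := by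
  rw [insTwo, insTwo, map_smul, dface_mon p (by omega), tot_succ, ← add_assoc]
  congr 1
  refine mon_congr R fun k hk => ?_
  simp only [insExp, contract]
  grind

theorem dface_insTwo_self (n c i l : ℕ) (e : ℕ → ℕ) :
    dface R p (n + 1) (n + 1) (insTwo (n + 1) c i l e) = insOne (n + 1) c (i + l) e := by
  rw [insTwo, insOne, map_smul, dface_mon p (by omega), ← add_assoc]
  congr 1
  refine mon_congr R fun k hk => ?_
  simp only [insExp, contract]
  grind

theorem tot_insExp {n m : ℕ} (h : m ≤ n) (c i l : ℕ) (e : ℕ → ℕ) :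
    tot (m + 1) (insExp (n + 1) c i l e) = c + tot (m + 1) e := by
  induction m with
  | zero => simp [tot_succ, insExp]; ring
  | succ m ih =>
    rw [tot_succ, ih (by omega), tot_succ (m + 1) e]
    simp [insExp, show m < n by omega, add_assoc]

theorem dface_insTwo_last (n c i l : ℕ) (e : ℕ → ℕ) :
    dface R p (n + 1) (n + 2) (insTwo (n + 1) c i l e) = insOne (n + 1) (c + l) i e := by
  rw [insTwo, insOne, map_smul, dface_last_mon, smul_smul, ← pow_add]
  congr 1
  · refine neg_one_pow_congr ?_
    rw [tot_succ (n + 1) (insExp _ _ _ _ _), tot_insExp le_rfl]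
    simp [insExp, parity_simps]
    tauto
  · refine mon_congr R fun k hk => ?_
    simp only [insExp, contract, push]
    grind

theorem insOne_zero (n : ℕ) (e : ℕ → ℕ) : insOne n 0 (e n) e = mon R n e := by
  rw [insOne, zero_mul, pow_zero, one_smul]
  refine mon_congr R fun k hk => ?_
  simp only [insExp]
  grind

theorem insTwo_eq_insOne (n c : ℕ) (e : ℕ → ℕ) :
    insTwo (n + 1) c (e (n + 1)) 0 e = insOne (R := R) (n + 2) c 0 e := by
  rw [insTwo, insOne, tot_succ (n + 1)]
  congr 1
  refine mon_congr R fun k hk => ?_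
  simp only [insExp]
  grind

theorem tot_contract_zero (n c : ℕ) (e : ℕ → ℕ) :
    tot (n + 1) (contract 0 (push c e)) = c + tot (n + 1) e := by
  rw [tot_contract (by omega), tot_push]

theorem insTwo_contract_push (n c d i l : ℕ) (e : ℕ → ℕ) (h : Even (c * (d + i + l + e (n + 1)))) :
    (-1 : R) ^ (c * tot (n + 2) e) • insTwo (R := R) (n + 1) d i l (contract 0 (push c e)) =
      insTwo (n + 1) (c + d) i l e := by
  rw [insTwo, insTwo, smul_smul, ← pow_add, tot_contract_zero, tot_succ (n + 1)]
  congr 1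
  · refine neg_one_pow_congr ?_
    simp only [Nat.even_add, Nat.even_mul] at h ⊢
    tauto
  · refine mon_congr R fun k hk => ?_
    simp only [insExp, contract, push]
    grind

theorem sum_insOne_telescope (n : ℕ) (e : ℕ → ℕ) (m : ℕ) :
    ∑ i ∈ Finset.range m, insOne (R := R) n (m - 1 - i) (i + 1) e =
      ∑ i ∈ Finset.range m, insOne n (m - 1 - i + 1) i e + insOne n 0 m e - insOne n m 0 e := by
  have h : ∀ i ∈ Finset.range m, insOne (R := R) n (m - 1 - i) (i + 1) e =
      insOne n (m - 1 - i + 1) i e + ((fun i => insOne n (m - i) i e) (i + 1) -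
        (fun i => insOne n (m - i) i e) i) := by
    intro i hi
    have := Finset.mem_range.1 hi
    dsimp only
    rw [show m - 1 - i + 1 = m - i by omega, show m - (i + 1) = m - 1 - i by omega]
    abel
  rw [Finset.sum_congr rfl h, Finset.sum_add_distrib,
    Finset.sum_range_sub (fun i => insOne (R := R) n (m - i) i e), Nat.sub_self,
    Nat.sub_zero, add_sub_assoc]

/-- The homotopy formula in Hochschild degree `n + 2`. The faces inside the first `n + 2` factors
cancel; the sums over `i` from the remaining faces telescope. -/
theorem b_htpy (n : ℕ) (x : Ch (n + 2)) : (alg R p).b (n + 2) (htpy R (n + 2) x) =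
    htpy R (n + 1) ((alg R p).b (n + 1) x) + (-1 : R) ^ n • x := by
  suffices h : (alg R p).b (n + 2) ∘ₗ htpy R (n + 2) =
      htpy R (n + 1) ∘ₗ (alg R p).b (n + 1) + (-1 : R) ^ n • LinearMap.id from
    LinearMap.congr_fun h x
  refine chain_ext fun e => ?_
  rw [LinearMap.add_apply, LinearMap.comp_apply, LinearMap.comp_apply, LinearMap.smul_apply,
    LinearMap.id_apply, b_eq_sum, b_eq_sum, LinearMap.sum_apply, LinearMap.sum_apply, map_sum,
    Finset.sum_range_succ, Finset.sum_range_succ, Finset.sum_range_succ, Finset.sum_range_succ _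
      (n + 2), Finset.sum_range_succ _ (n + 1)]
  simp only [LinearMap.smul_apply, map_smul]
  set a := e (n + 1) with ha
  set c := e (n + 2) with hc
  -- `h1` to `h4` evaluate `b ∘ htpy` face by face, `h5` and `h6` the last two faces of `htpy ∘ b`
  have h1 : ∀ j ∈ Finset.range (n + 1),
      (-1 : R) ^ j • dface R p (n + 2) j (htpy R (n + 2) (mon R (n + 2) e)) =
      (-1 : R) ^ j • htpy R (n + 1) (dface R p (n + 1) j (mon R (n + 2) e)) := by
    intro j hj
    have hj' := Finset.mem_range.1 hj
    have hc' : contract j e (n + 1) = c := by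
      simp [contract, show ¬ n + 1 < j by omega, show n + 1 ≠ j by omega, hc]
    rw [htpy_mon, dface_mon p (by omega), htpy_mon, hc', map_sub, map_sum,
      dface_insTwo_of_lt p (by omega)]
    simp only [dface_insTwo_of_lt p (Nat.lt_succ_iff.1 hj')]
    rfl
  have h2 : dface R p (n + 2) (n + 1) (htpy R (n + 2) (mon R (n + 2) e)) =
      ∑ i ∈ Finset.range c, insTwo (n + 1) (c - 1 - i) (a + i) 1 e - insOne (n + 2) c 0 e := by
    rw [htpy_mon, map_sub, map_sum]
    simp only [dface_insTwo_pred]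
    rw [add_zero, insTwo_eq_insOne]
  have h3 : dface R p (n + 2) (n + 2) (htpy R (n + 2) (mon R (n + 2) e)) =
      ∑ i ∈ Finset.range c, insOne (n + 2) (c - 1 - i) (i + 1) e - insOne (n + 2) c 0 e := by
    rw [htpy_mon, map_sub, map_sum]
    simp only [dface_insTwo_self]
    rfl
  have h4 : dface R p (n + 2) (n + 3) (htpy R (n + 2) (mon R (n + 2) e)) =
      ∑ i ∈ Finset.range c, insOne (n + 2) (c - 1 - i + 1) i e - insOne (n + 2) c 0 e := by
    rw [htpy_mon, map_sub, map_sum]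
    simp only [dface_insTwo_last]
    rfl
  have h5 : htpy R (n + 1) (dface R p (n + 1) (n + 1) (mon R (n + 2) e)) =
      ∑ i ∈ Finset.range (a + c), insTwo (n + 1) (a + c - 1 - i) i 1 e -
        insTwo (n + 1) (a + c) 0 0 e := by
    have hc' : contract (n + 1) e (n + 1) = a + c := by simp [contract, ha, hc]
    have he : ∀ i < n + 1, contract (n + 1) e i = e i := fun i hi => by simp [contract, hi]
    rw [dface_mon p le_rfl, htpy_mon, hc', insTwo_congr he]
    simp only [insTwo_congr he]
  have h6 : htpy R (n + 1) (dface R p (n + 1) (n + 2) (mon R (n + 2) e)) =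
      ∑ i ∈ Finset.range a, insTwo (n + 1) (a + c - 1 - i) i 1 e -
        insTwo (n + 1) (a + c) 0 0 e := by
    have ha' : contract 0 (push c e) (n + 1) = a := by simp [contract, push, ha]
    rw [dface_last_mon, map_smul, htpy_mon, smul_sub, Finset.smul_sum, ← hc, ha',
      insTwo_contract_push, add_comm c a]
    · congr 1
      refine Finset.sum_congr rfl fun i hi => ?_
      have hi' := Finset.mem_range.1 hi
      rw [insTwo_contract_push]
      · congr 1; omega
      · rw [← ha, show a - 1 - i + i + 1 + a = 2 * a by omega]
        exact (even_two_mul a).mul_left c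
    · rw [← ha, show a + 0 + 0 + a = 2 * a by omega]
      exact (even_two_mul a).mul_left c
  have h7 : ∑ i ∈ Finset.range (a + c), insTwo (R := R) (n + 1) (a + c - 1 - i) i 1 e =
      ∑ i ∈ Finset.range a, insTwo (n + 1) (a + c - 1 - i) i 1 e +
        ∑ i ∈ Finset.range c, insTwo (n + 1) (c - 1 - i) (a + i) 1 e := by
    rw [Finset.sum_range_add]
    congr 1
    refine Finset.sum_congr rfl fun i hi => ?_
    rw [show a + c - 1 - (a + i) = c - 1 - i by omega]
  have h8 : insOne (n + 2) 0 c e = mon R (n + 2) e := insOne_zero (n + 2) e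
  rw [Finset.sum_congr rfl h1, h2, h3, h4, h5, h6, h7, sum_insOne_telescope, h8]
  simp only [pow_succ]
  module

variable (R) in
/-- The signed number `∑_{i < e} ± 1` of occurrences of `x^(a+e-1) dx` in
`x^a d(x^e) = ∑_i x^a x^i dx x^(e-1-i)`, where differential forms are taken modulo graded
commutators. -/
def formCoeff (a e : ℕ) : R := ∑ i ∈ Finset.range e, (-1) ^ ((e - 1 - i) * (a + i + 1))

theorem formCoeff_eq (a e : ℕ) :
    formCoeff R a e = if Odd (a + e) then (e : R) else parity R e := by
  have h : formCoeff R a e = ∑ i ∈ Finset.range e, (-1 : R) ^ (i * (a + e + 1)) := by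
    rw [formCoeff, ← Finset.sum_range_reflect]
    refine Finset.sum_congr rfl fun i hi => neg_one_pow_congr ?_
    have := Finset.mem_range.1 hi
    obtain ⟨d, rfl⟩ : ∃ d, e = i + 1 + d := ⟨e - (i + 1), by omega⟩
    rw [show i + 1 + d - 1 - (i + 1 + d - 1 - i) = i by omega,
      show i + 1 + d - 1 - i = d by omega]
    simp only [Nat.even_add, Nat.even_mul, Nat.not_even_one]
    tauto
  rw [h]
  split_ifs with ho
  · rw [Finset.sum_congr rfl fun i _ => Even.neg_one_pow ((ho.add_odd odd_one).mul_left i)]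
    simp
  · have ho' : Odd (a + e + 1) := (Nat.not_odd_iff_even.1 ho).add_odd odd_one
    rw [Finset.sum_congr rfl fun i _ => by rw [mul_comm, pow_mul, ho'.neg_one_pow]]
    induction e with
    | zero => simp [parity]
    | succ e _ =>
      rw [neg_one_geom_sum]
      unfold parity
      rcases Nat.even_or_odd (e + 1) with h' | h'
      · rw [if_pos h', if_neg (Nat.not_odd_iff_even.2 h')]
      · rw [if_neg (Nat.not_even_iff_odd.2 h'), if_pos h']

/-- The exponents of `x^a ⊗ x^c`. -/
def pairExp (a c k : ℕ) : ℕ := if k = 0 then a else c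

variable (R) in
/-- The projector of `R[x] ⊗ R[x]` that sends `x^a ⊗ x^e` to the representative of `x^a d(x^e)` of
the form `c • x^(a+e-1) ⊗ x`. -/
noncomputable def formProj : Ch 1 →ₗ[R] Ch 1 :=
  ofMon 1 fun e => formCoeff R (e 0) (e 1) • mon R 1 (pairExp (e 0 + e 1 - 1) 1)

theorem formProj_mon (e : ℕ → ℕ) : formProj R (mon R 1 e) =
    formCoeff R (e 0) (e 1) • mon R 1 (pairExp (e 0 + e 1 - 1) 1) :=
  ofMon_mon (fun e e' h => by rw [h 0 (by omega), h 1 le_rfl]) e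

/-- In Hochschild degree one, `htpy` connects the identity with the projection to forms. -/
theorem b_htpy_one (x : Ch 1) : (alg R p).b 1 (htpy R 1 x) = formProj R x - x := by
  suffices h : (alg R p).b 1 ∘ₗ htpy R 1 = formProj R - LinearMap.id from
    LinearMap.congr_fun h x
  refine chain_ext fun e => ?_
  rw [LinearMap.sub_apply, LinearMap.comp_apply, LinearMap.id_apply, b_eq_sum, LinearMap.sum_apply,
    Finset.sum_range_succ, Finset.sum_range_succ, Finset.sum_range_one, formProj_mon]
  simp only [LinearMap.smul_apply]
  set a := e 0 with ha
  set c := e 1 with hc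
  have h2 : dface R p 1 0 (htpy R 1 (mon R 1 e)) =
      formCoeff R a c • mon R 1 (pairExp (a + c - 1) 1) - insOne 1 c 0 e := by
    rw [htpy_mon, map_sub, map_sum, formCoeff, Finset.sum_smul]
    congr 1
    · refine Finset.sum_congr rfl fun i hi => ?_
      have := Finset.mem_range.1 hi
      rw [insTwo, map_smul, dface_mon p (by omega), tot_succ, tot_zero, zero_add]
      congr 1
      refine mon_congr R fun k hk => ?_
      simp only [insExp, contract, pairExp]
      grind
    · rw [insTwo, insOne, map_smul, dface_mon p (by omega)]
      congr 1
      refine mon_congr R fun k hk => ?_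
      simp only [insExp, contract]
      grind
  have h3 : dface R p 1 1 (htpy R 1 (mon R 1 e)) =
      ∑ i ∈ Finset.range c, insOne 1 (c - 1 - i) (i + 1) e - insOne 1 c 0 e := by
    rw [htpy_mon, map_sub, map_sum]
    simp only [dface_insTwo_self p 0]
    rfl
  have h4 : dface R p 1 2 (htpy R 1 (mon R 1 e)) =
      ∑ i ∈ Finset.range c, insOne 1 (c - 1 - i + 1) i e - insOne 1 c 0 e := by
    rw [htpy_mon, map_sub, map_sum]
    simp only [dface_insTwo_last p 0]
    rfl
  have h8 : insOne 1 0 c e = mon R 1 e := insOne_zero 1 e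
  rw [h2, h3, h4, sum_insOne_telescope, h8]
  simp only [pow_succ, pow_zero]
  module

end Homotopy
end KillP

/-! ### Internal degrees and acyclicity of the kernel -/

namespace KillP
section Degrees
variable {R : Type*} [CommRing R] (p : ℕ)

local notation "Ch" => Hoch.Chain R R[X]

theorem mon_mem_chainDeg {n : ℕ} {q : ℤ} (e : ℕ → ℕ) (h : (tot (n + 1) e : ℤ) = q) :
    mon R n e ∈ (alg R p).chainDeg n q := by
  refine Submodule.subset_span ⟨fun i => e i, fun i => Polynomial.monomial (e i) 1,
    fun i => ⟨1, rfl⟩, ?_, rfl⟩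
  rw [← h, tot, Fin.sum_univ_eq_sum_range (fun i => (e i : ℤ))]
  push_cast
  rfl

theorem chainDeg_eq_span (n : ℕ) (q : ℤ) : (alg R p).chainDeg n q =
    Submodule.span R {z | ∃ e : ℕ → ℕ, (tot (n + 1) e : ℤ) = q ∧ z = mon R n e} := by
  apply le_antisymm
  · refine Submodule.span_le.2 ?_
    rintro _ ⟨e, a, ha, he, rfl⟩
    choose r hr using ha
    have h : PiTensorProduct.tprod R a = (∏ i, r i) • mon R n (extend e) := by
      rw [mon, ← MultilinearMap.map_smul_univ]
      congr 1
      funext i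
      rw [← hr i, Polynomial.smul_monomial, smul_eq_mul, mul_one, extend, dif_pos i.2]
    rw [h]
    refine Submodule.smul_mem _ _ (Submodule.subset_span ⟨_, ?_, rfl⟩)
    rw [← he, tot, ← Fin.sum_univ_eq_sum_range, Nat.cast_sum]
    exact Finset.sum_congr rfl fun i _ => by rw [extend, dif_pos i.2]
  · refine Submodule.span_le.2 ?_
    rintro _ ⟨e, he, rfl⟩
    exact mon_mem_chainDeg p e he

/-- A linear map between spaces of chains that shifts the internal degree by `d`. -/
def IsHomog {n m : ℕ} (d : ℤ) (f : Ch n →ₗ[R] Ch m) : Prop :=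
  ∀ q, ∀ x ∈ (alg R p).chainDeg n q, f x ∈ (alg R p).chainDeg m (q + d)

variable {p} {n m l : ℕ} {d d' : ℤ}

theorem isHomog_of_mon {f : Ch n →ₗ[R] Ch m}
    (h : ∀ e, f (mon R n e) ∈ (alg R p).chainDeg m (tot (n + 1) e + d)) : IsHomog p d f := by
  intro q x hx
  rw [chainDeg_eq_span] at hx
  induction hx using Submodule.span_induction with
  | mem x hx =>
    obtain ⟨e, rfl, rfl⟩ := hx
    exact h e
  | zero => rw [map_zero]; exact Submodule.zero_mem _
  | add x y _ _ hx hy => rw [map_add]; exact Submodule.add_mem _ hx hy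
  | smul c x _ hx => rw [map_smul]; exact Submodule.smul_mem _ _ hx

theorem IsHomog.add {f g : Ch n →ₗ[R] Ch m} (hf : IsHomog p d f) (hg : IsHomog p d g) :
    IsHomog p d (f + g) := fun q x hx => Submodule.add_mem _ (hf q x hx) (hg q x hx)

theorem IsHomog.smul {f : Ch n →ₗ[R] Ch m} (hf : IsHomog p d f) (c : R) :
    IsHomog p d (c • f) := fun q x hx => Submodule.smul_mem _ _ (hf q x hx)

theorem IsHomog.sub {f g : Ch n →ₗ[R] Ch m} (hf : IsHomog p d f) (hg : IsHomog p d g) :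
    IsHomog p d (f - g) := fun q x hx => Submodule.sub_mem _ (hf q x hx) (hg q x hx)

theorem IsHomog.sum {ι : Type*} {s : Finset ι} {f : ι → Ch n →ₗ[R] Ch m}
    (h : ∀ i ∈ s, IsHomog p d (f i)) : IsHomog p d (∑ i ∈ s, f i) := by
  intro q x hx
  rw [LinearMap.sum_apply]
  exact Submodule.sum_mem _ fun i hi => h i hi q x hx

theorem IsHomog.comp {f : Ch n →ₗ[R] Ch m} {g : Ch m →ₗ[R] Ch l} (hg : IsHomog p 0 g)
    (hf : IsHomog p 0 f) : IsHomog p 0 (g ∘ₗ f) := by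
  intro q x hx
  have := hg _ _ (hf q x hx)
  rwa [add_zero] at this

theorem isHomog_id : IsHomog p 0 (LinearMap.id : Ch n →ₗ[R] Ch n) := by
  intro q x hx
  rwa [add_zero]

theorem IsHomog.pow {f : Ch n →ₗ[R] Ch n} (hf : IsHomog p 0 f) (i : ℕ) : IsHomog p 0 (f ^ i) := by
  induction i with
  | zero => exact isHomog_id
  | succ i ih => rw [pow_succ]; exact ih.comp hf

theorem isHomog_rot : IsHomog (R := R) p 0 ((alg R p).rot n) := by
  refine isHomog_of_mon fun e => ?_
  rw [rot_mon]
  refine Submodule.smul_mem _ _ (mon_mem_chainDeg p _ ?_)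
  rw [tot_push, tot_succ]
  push_cast
  ring

theorem isHomog_cyc : IsHomog (R := R) p 0 ((alg R p).cyc n) := isHomog_rot.smul _

theorem isHomog_dface {j : ℕ} (hj : j ≤ n + 1) : IsHomog p 0 (dface R p n j) := by
  have h : ∀ j ≤ n, IsHomog p 0 (dface R p n j) := by
    intro j hj
    refine isHomog_of_mon fun e => ?_
    rw [dface_mon p hj]
    refine mon_mem_chainDeg p _ ?_
    rw [tot_contract (by omega), add_zero]
  rcases Nat.lt_or_ge n j with h' | h'
  · obtain rfl : j = n + 1 := by omega
    rw [dface_last]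
    exact (h 0 (by omega)).comp isHomog_rot
  · exact h j h'

theorem isHomog_b : IsHomog (R := R) p 0 ((alg R p).b n) := by
  rw [b_eq_sum]
  exact IsHomog.sum fun j hj => (isHomog_dface (by have := Finset.mem_range.1 hj; omega)).smul _

theorem isHomog_extra : IsHomog p 0 (Hoch.extra R R[X] n) := by
  refine isHomog_of_mon fun e => ?_
  rw [extra_mon]
  refine mon_mem_chainDeg p _ ?_
  rw [tot_push, zero_add, add_zero]

theorem isHomog_connes : IsHomog (R := R) p 0 ((alg R p).connes n) :=
  (isHomog_id.sub isHomog_cyc).comp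
    (isHomog_extra.comp (IsHomog.sum fun i _ => isHomog_cyc.pow i))

theorem isHomog_inner : IsHomog (R := R) p (-1) ((alg R p).inner n) := by
  refine isHomog_of_mon fun e => ?_
  rw [inner_mon]
  refine Submodule.smul_mem _ _ (Submodule.sum_mem _ fun i hi => ?_)
  by_cases h : parity R (e i) = 0
  · rw [h, mul_zero, zero_smul]
    exact Submodule.zero_mem _
  refine Submodule.smul_mem _ _ (mon_mem_chainDeg p _ ?_)
  have := tot_lower (Finset.mem_range.1 hi) e (odd_of_parity_ne_zero h).pos
  omega

theorem tot_insExp_add_two (n c i l : ℕ) (e : ℕ → ℕ) :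
    tot (n + 3) (insExp (n + 1) c i l e) = c + tot (n + 1) e + i + l := by
  rw [tot_succ, tot_succ, tot_insExp le_rfl]
  simp [insExp]

theorem isHomog_htpy : IsHomog p 0 (htpy R (n + 1)) := by
  refine isHomog_of_mon fun e => ?_
  have h : ∀ c i l, c + i + l = e (n + 1) →
      insTwo (n + 1) c i l e ∈ (alg R p).chainDeg (n + 2) (tot (n + 2) e + 0) := by
    intro c i l h
    refine Submodule.smul_mem _ _ (mon_mem_chainDeg p _ ?_)
    rw [tot_insExp_add_two, tot_succ (n + 1) e]
    omega
  rw [htpy_mon]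
  refine Submodule.sub_mem _ (Submodule.sum_mem _ fun i hi => h _ _ _ ?_) (h _ _ _ rfl)
  have := Finset.mem_range.1 hi
  omega

variable (p)

theorem chainDeg_eq_bot {q : ℤ} (h : q < 0) : (alg R p).chainDeg n q = ⊥ := by
  rw [chainDeg_eq_span, Submodule.span_eq_bot]
  rintro _ ⟨e, he, rfl⟩
  omega

theorem mem_totDeg {m : ℤ} {f : (alg R p).Tot} :
    f ∈ (alg R p).totDeg m ↔ ∀ k n : ℕ, f k n ∈ (alg R p).chainDeg n (m - 2 * k - n) := by
  simp [DGAlg.totDeg, Submodule.mem_pi]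

theorem totD_mem {m : ℤ} {f : (alg R p).Tot} (h : f ∈ (alg R p).totDeg (m + 1)) :
    (alg R p).totD f ∈ (alg R p).totDeg m := by
  rw [mem_totDeg] at h ⊢
  have hb : ∀ k n : ℕ, (alg R p).b n (f k (n + 1)) ∈ (alg R p).chainDeg n (m - 2 * k - n) := by
    intro k n
    convert isHomog_b _ _ (h k (n + 1)) using 1
    push_cast
    ring_nf
  have hi : ∀ k n : ℕ, (alg R p).inner n (f k n) ∈ (alg R p).chainDeg n (m - 2 * k - n) := by
    intro k n
    convert isHomog_inner _ _ (h k n) using 1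
    ring_nf
  intro k n
  rcases n with _ | n
  · rw [totD_apply_zero]
    exact Submodule.add_mem _ (hb k 0) (hi k 0)
  · rw [totD_apply_succ]
    refine Submodule.add_mem _ (Submodule.add_mem _ (hb k _) (Submodule.smul_mem _ _ (hi k _))) ?_
    convert isHomog_connes _ _ (h (k + 1) n) using 1
    push_cast
    ring_nf

/-- One step of the zigzag that shows that the kernel of the projection onto forms is acyclic: a
chain that vanishes in Hochschild degrees below `s` is pushed to Hochschild degree `s + 1` by
subtracting a boundary. -/
theorem exists_totD_eq_step {m : ℤ} {s : ℕ} (hs : 1 ≤ s) {z : (alg R p).Tot}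
    (hz : z ∈ (alg R p).totDeg m) (h0 : ∀ k, ∀ n < s, z k n = 0)
    (hb : ∀ k, (alg R p).b s (htpy R s (z k s)) = (-1 : R) ^ s • z k s) :
    ∃ w ∈ (alg R p).totDeg (m + 1), (∀ k, ∀ n ≤ s, w k n = 0) ∧
      ∀ k, ∀ n < s + 1, (z - (alg R p).totD w) k n = 0 := by
  refine ⟨fun k => Pi.single (s + 1) ((-1 : R) ^ s • htpy R s (z k s)), ?_, ?_, ?_⟩
  · rw [mem_totDeg] at hz ⊢
    intro k n
    by_cases h : n = s + 1
    · subst h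
      rw [Pi.single_eq_same]
      refine Submodule.smul_mem _ _ ?_
      obtain ⟨s, rfl⟩ : ∃ t, s = t + 1 := ⟨s - 1, by omega⟩
      convert isHomog_htpy _ _ (hz k (s + 1)) using 1
      push_cast
      ring_nf
    · rw [Pi.single_eq_of_ne h]
      exact Submodule.zero_mem _
  · intro k n hn
    exact Pi.single_eq_of_ne (by omega) _
  · intro k n hn
    rw [Pi.sub_apply, Pi.sub_apply, sub_eq_zero]
    have h1 : (alg R p).b n ((Pi.single (s + 1) ((-1 : R) ^ s • htpy R s (z k s)) :
        (n : ℕ) → Ch n) (n + 1)) = z k n := by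
      by_cases h : n = s
      · subst h
        rw [Pi.single_eq_same, map_smul, hb, smul_smul, ← mul_pow]
        simp
      · rw [Pi.single_eq_of_ne (by omega), map_zero, h0 k n (by omega)]
    rcases n with _ | n
    · rw [totD_apply_zero, h1, Pi.single_eq_of_ne (by omega), map_zero, add_zero]
    · rw [totD_apply_succ, h1, Pi.single_eq_of_ne (by omega), Pi.single_eq_of_ne (by omega),
        map_zero, map_zero, smul_zero, add_zero, add_zero]

/-- A cycle whose components of Hochschild degree `0`, and whose projections to differential forms
in Hochschild degree `1`, all vanish is the boundary of a chain that is concentrated in Hochschild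
degrees at least two. -/
theorem exists_totD_eq {m : ℤ} {f : (alg R p).Tot} (hf : f ∈ (alg R p).totDeg m)
    (hD : (alg R p).totD f = 0) (h0 : ∀ k, f k 0 = 0) (h1 : ∀ k, formProj R (f k 1) = 0) :
    ∃ w ∈ (alg R p).totDeg (m + 1), (∀ k, w k 0 = 0 ∧ w k 1 = 0) ∧ (alg R p).totD w = f := by
  have key : ∀ s, ∃ w ∈ (alg R p).totDeg (m + 1), (∀ k, w k 0 = 0 ∧ w k 1 = 0) ∧
      ∀ k, ∀ n < s + 2, (f - (alg R p).totD w) k n = 0 := by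
    intro s
    induction s with
    | zero =>
      obtain ⟨w, hw, hw0, hw1⟩ := exists_totD_eq_step p le_rfl hf
        (fun k n hn => by rw [Nat.lt_one_iff.1 hn, h0]) (fun k => by rw [b_htpy_one, h1]; simp)
      exact ⟨w, hw, fun k => ⟨hw0 k 0 (by omega), hw0 k 1 le_rfl⟩, hw1⟩
    | succ s ih =>
      obtain ⟨w, hw, hw0, hw1⟩ := ih
      have hz := Submodule.sub_mem _ hf (totD_mem p hw)
      have hDz : (alg R p).totD (f - (alg R p).totD w) = 0 := by
        rw [map_sub, hD, totD_totD, sub_zero]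
      set z := f - (alg R p).totD w with hzdef
      have hbz : ∀ k, (alg R p).b (s + 1) (z k (s + 2)) = 0 := by
        intro k
        have h := congrFun (congrFun hDz k) (s + 1)
        rwa [totD_apply_succ, hw1 k (s + 1) (by omega), hw1 (k + 1) s (by omega), map_zero,
          map_zero, smul_zero, add_zero, add_zero] at h
      obtain ⟨v, hv, hv0, hv1⟩ := exists_totD_eq_step p (s := s + 2) (by omega) hz hw1 fun k => by
        rw [b_htpy, hbz, map_zero, zero_add, pow_succ, pow_succ]
        simp
      refine ⟨w + v, Submodule.add_mem _ hw hv, fun k => ⟨?_, ?_⟩, fun k n hn => ?_⟩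
      · rw [Pi.add_apply, Pi.add_apply, (hw0 k).1, hv0 k 0 (by omega), add_zero]
      · rw [Pi.add_apply, Pi.add_apply, (hw0 k).2, hv0 k 1 (by omega), add_zero]
      · rw [map_add, ← sub_sub]
        exact hv1 k n hn
  obtain ⟨w, hw, hw0, hw1⟩ := key m.toNat
  refine ⟨w, hw, hw0, ?_⟩
  have hz := Submodule.sub_mem _ hf (totD_mem p hw)
  rw [mem_totDeg] at hz
  refine (sub_eq_zero.1 ?_).symm
  funext k n
  rcases Nat.lt_or_ge n (m.toNat + 2) with h | h
  · exact hw1 k n h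
  · have := hz k n
    rwa [chainDeg_eq_bot p (by omega), Submodule.mem_bot] at this

end Degrees
end KillP

/-! ### Coordinates in the small model -/

namespace KillP
section Coordinates
variable {R : Type*} [CommRing R] (p : ℕ)

local notation "Ch" => Hoch.Chain R R[X]

variable (R) in
/-- The coefficient of `x^m`. -/
noncomputable def coefX (m : ℕ) : Ch 0 →ₗ[R] R := ofMon 0 fun e => if e 0 = m then 1 else 0

variable (R) in
/-- The coefficient of `x^(m-1) dx` in the differential form, modulo graded commutators, that is
represented by a chain of Hochschild degree one. -/
noncomputable def coefY (m : ℕ) : Ch 1 →ₗ[R] R :=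
  ofMon 1 fun e => if e 0 + e 1 = m then formCoeff R (e 0) (e 1) else 0

theorem coefX_mon (m : ℕ) (e : ℕ → ℕ) : coefX R m (mon R 0 e) = if e 0 = m then 1 else 0 :=
  ofMon_mon (fun e e' h => by rw [h 0 le_rfl]) e

theorem coefY_mon (m : ℕ) (e : ℕ → ℕ) :
    coefY R m (mon R 1 e) = if e 0 + e 1 = m then formCoeff R (e 0) (e 1) else 0 :=
  ofMon_mon (fun e e' h => by rw [h 0 (by omega), h 1 le_rfl]) e

theorem coefY_zero : coefY R 0 = 0 := by
  refine chain_ext fun e => ?_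
  rw [coefY_mon, LinearMap.zero_apply]
  split_ifs with h
  · rw [show e 1 = 0 by omega]
    rfl
  · rfl

theorem b_zero_mon (e : ℕ → ℕ) : (alg R p).b 0 (mon R 1 e) =
    (1 - (-1 : R) ^ (e 0 * e 1)) • mon R 0 (fun _ => e 0 + e 1) := by
  rw [b_eq_sum, LinearMap.sum_apply, Finset.sum_range_succ, Finset.sum_range_one,
    LinearMap.smul_apply, LinearMap.smul_apply, dface_mon p le_rfl, dface_last_mon, tot_succ 0,
    tot_zero, zero_add (e 0), mul_comm (e (0 + 1)) (e 0), mon_congr R (e := contract 0 e) (e' := fun _ => e 0 + e 1),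
    mon_congr R (e := contract 0 _) (e' := fun _ => e 0 + e 1)]
  · simp only [pow_zero, pow_one]
    module
  · intro i hi
    obtain rfl : i = 0 := by omega
    simp [contract, push, add_comm]
  · intro i hi
    obtain rfl : i = 0 := by omega
    simp [contract]

theorem coefX_b (m : ℕ) (z : Ch 1) :
    coefX R m ((alg R p).b 0 z) = if Even m then 2 * coefY R m z else 0 := by
  suffices h : coefX R m ∘ₗ (alg R p).b 0 = (if Even m then (2 : R) else 0) • coefY R m by
    have := LinearMap.congr_fun h z
    rw [LinearMap.comp_apply, LinearMap.smul_apply] at this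
    rw [this]
    split_ifs <;> simp
  refine chain_ext fun e => ?_
  rw [LinearMap.comp_apply, LinearMap.smul_apply, b_zero_mon, map_smul, coefX_mon, coefY_mon,
    formCoeff_eq]
  by_cases hm : e 0 + e 1 = m
  · subst hm
    unfold parity
    rcases Nat.even_or_odd (e 0) with h0 | h0 <;> rcases Nat.even_or_odd (e 1) with h1 | h1
    · simp [h1, h0.add h1, (h0.mul_right (e 1)).neg_one_pow, Nat.not_odd_iff_even.2]
    · simp [Nat.not_even_iff_odd.2 (h0.add_odd h1), (h0.mul_right (e 1)).neg_one_pow]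
    · simp [Nat.not_even_iff_odd.2 (h0.add_even h1), (h1.mul_left (e 0)).neg_one_pow]
    · simp [h1, h0.add_odd h1, Nat.not_odd_iff_even.2 (h0.add_odd h1), (h0.mul h1).neg_one_pow]
      norm_num
  · simp [hm]

theorem coefX_inner (m : ℕ) (z : Ch 0) : coefX R m ((alg R p).inner 0 z) =
    if Even m then p * coefX R (m + 1) z else 0 := by
  suffices h : coefX R m ∘ₗ (alg R p).inner 0 =
      (if Even m then (p : R) else 0) • coefX R (m + 1) by
    have := LinearMap.congr_fun h z
    rw [LinearMap.comp_apply, LinearMap.smul_apply] at this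
    rw [this]
    split_ifs <;> simp
  refine chain_ext fun e => ?_
  rw [LinearMap.comp_apply, LinearMap.smul_apply, inner_mon, Finset.sum_range_one, map_smul,
    map_smul, coefX_mon, coefX_mon, tot_zero, pow_zero, one_mul]
  unfold parity
  simp only [lower, if_true]
  rcases Nat.even_or_odd (e 0) with h0 | h0
  · have : ¬ (Even m ∧ e 0 = m + 1) := by
      rintro ⟨h1, h2⟩
      rw [h2] at h0
      exact Nat.not_even_iff_odd.2 h1.add_one h0
    rw [if_neg (Nat.not_odd_iff_even.2 h0)]
    by_cases h1 : Even m
    · simp [show e 0 ≠ m + 1 from fun h => this ⟨h1, h⟩]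
    · simp [h1]
  · have := h0.pos
    by_cases h2 : e 0 = m + 1
    · have h3 : Even m := by
        rw [h2] at h0
        simpa [parity_simps] using h0
      simp [h2, h3, h3.add_one]
    · simp [h2, show e 0 - 1 ≠ m by omega]

theorem coefY_b (m : ℕ) (z : Ch 2) : coefY R m ((alg R p).b 1 z) = 0 := by
  suffices h : coefY R m ∘ₗ (alg R p).b 1 = 0 from LinearMap.congr_fun h z
  refine chain_ext fun e => ?_
  rw [LinearMap.comp_apply, b_eq_sum, LinearMap.sum_apply, Finset.sum_range_succ,
    Finset.sum_range_succ, Finset.sum_range_one]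
  simp only [LinearMap.smul_apply, map_add, map_smul]
  rw [dface_mon p (by omega), dface_mon p le_rfl, dface_last_mon, map_smul, coefY_mon, coefY_mon,
    coefY_mon, tot_succ, tot_succ, tot_zero, zero_add, LinearMap.zero_apply]
  simp only [contract, push]
  norm_num
  generalize e 0 = a
  generalize e 1 = c
  generalize e 2 = d
  by_cases hm : a + c + d = m
  · rw [if_pos hm, if_pos (by omega), if_pos (by omega), formCoeff_eq, formCoeff_eq, formCoeff_eq,
      ← add_assoc, show d + a + c = a + c + d by ring]
    unfold parity
    by_cases h0 : Even a <;> by_cases h1 : Even c <;> by_cases h2 : Even d <;>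
      simp [h0, h1, h2, parity_simps, ← Nat.not_even_iff_odd]
  · rw [if_neg hm, if_neg (by omega), if_neg (by omega)]
    simp

theorem coefY_inner (m : ℕ) (z : Ch 1) : coefY R m ((alg R p).inner 1 z) =
    if Odd m then p * coefY R (m + 1) z else 0 := by
  suffices h : coefY R m ∘ₗ (alg R p).inner 1 =
      (if Odd m then (p : R) else 0) • coefY R (m + 1) by
    have := LinearMap.congr_fun h z
    rw [LinearMap.comp_apply, LinearMap.smul_apply] at this
    rw [this]
    split_ifs <;> simp
  refine chain_ext fun e => ?_
  rw [LinearMap.comp_apply, LinearMap.smul_apply, inner_mon, Finset.sum_range_succ,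
    Finset.sum_range_one, map_smul, map_add, map_smul, map_smul, coefY_mon, coefY_mon, coefY_mon,
    tot_succ, tot_zero, pow_zero, one_mul, zero_add]
  simp only [lower, if_true]
  norm_num
  generalize e 0 = a
  generalize e 1 = c
  rcases Nat.even_or_odd a with h0 | h0 <;> rcases Nat.even_or_odd c with h1 | h1
  · have h2 : formCoeff R a c = 0 := by
      simp [formCoeff_eq, parity, ← Nat.not_even_iff_odd, h0.add h1, h1]
    simp [h2, parity, Nat.not_odd_iff_even.2, h0, h1]
  · obtain ⟨c, rfl⟩ : ∃ d, c = d + 1 := ⟨c - 1, by have := h1.pos; omega⟩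
    have h1' : Even c := by simpa [parity_simps] using h1
    have h2 : formCoeff R a c = 0 := by
      simp [formCoeff_eq, parity, ← Nat.not_even_iff_odd, h0.add h1', h1']
    rw [show parity R a = 0 from if_neg (Nat.not_odd_iff_even.2 h0)]
    simp only [zero_mul, ite_self, Nat.add_sub_cancel, h2, mul_zero, add_zero]
    split_ifs with h3 h4
    · rw [← add_assoc] at h3
      rw [← Nat.succ_injective h3] at h4
      exact absurd (h0.add h1') (Nat.not_even_iff_odd.2 h4)
    · rfl
    · rfl
  · obtain ⟨a, rfl⟩ : ∃ d, a = d + 1 := ⟨a - 1, by have := h0.pos; omega⟩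
    have h0' : Even a := by simpa [parity_simps] using h0
    have h2 : formCoeff R a c = 0 := by
      simp [formCoeff_eq, parity, ← Nat.not_even_iff_odd, h0'.add h1, h1]
    rw [show parity R c = 0 from if_neg (Nat.not_odd_iff_even.2 h1)]
    simp only [zero_mul, ite_self, Nat.add_sub_cancel, h2, mul_zero, add_zero]
    split_ifs with h3 h4
    · rw [add_right_comm] at h3
      rw [← Nat.succ_injective h3] at h4
      exact absurd (h0'.add h1) (Nat.not_even_iff_odd.2 h4)
    · rfl
    · rfl
  · obtain ⟨a, rfl⟩ : ∃ d, a = d + 1 := ⟨a - 1, by have := h0.pos; omega⟩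
    obtain ⟨c, rfl⟩ : ∃ d, c = d + 1 := ⟨c - 1, by have := h1.pos; omega⟩
    have h0' : Even a := by simpa [parity_simps] using h0
    have h1' : Even c := by simpa [parity_simps] using h1
    have h2 : formCoeff R a (c + 1) = c + 1 := by
      rw [formCoeff_eq, if_pos (h0'.add_odd h1), Nat.cast_succ]
    have h3 : formCoeff R (a + 1) c = c := by rw [formCoeff_eq, if_pos (h0.add_even h1')]
    have h4 : formCoeff R (a + 1) (c + 1) = 1 := by
      rw [formCoeff_eq, if_neg (Nat.not_odd_iff_even.2 (h0.add_odd h1)), parity, if_pos h1]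
    rw [show parity R (a + 1) = 1 from if_pos h0, show parity R (c + 1) = 1 from if_pos h1,
      h0.neg_one_pow]
    simp only [Nat.add_sub_cancel, h2, h3, h4]
    by_cases hm : a + c + 1 = m
    · have hm' : Odd m := by rw [← hm]; exact (h0'.add h1').add_one
      rw [if_pos (by omega), if_pos (by omega), if_pos (by omega), if_pos hm']
      ring
    · rw [if_neg (by omega), if_neg (by omega), if_neg (by omega)]
      ring

theorem coefY_connes (m : ℕ) (z : Ch 0) : coefY R m ((alg R p).connes 0 z) =
    if Odd m then m * coefX R m z else 0 := by
  suffices h : coefY R m ∘ₗ (alg R p).connes 0 = (if Odd m then (m : R) else 0) • coefX R m by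
    have := LinearMap.congr_fun h z
    rw [LinearMap.comp_apply, LinearMap.smul_apply] at this
    rw [this]
    split_ifs <;> simp
  refine chain_ext fun e => ?_
  have hn : (alg R p).norm 0 = LinearMap.id := by
    rw [DGAlg.norm, Finset.sum_range_one, pow_zero, Module.End.one_eq_id]
  rw [LinearMap.comp_apply, LinearMap.smul_apply, DGAlg.connes, LinearMap.comp_apply,
    LinearMap.comp_apply, hn, LinearMap.id_apply, extra_mon, LinearMap.sub_apply,
    LinearMap.id_apply, DGAlg.cyc, LinearMap.smul_apply, rot_mon, map_sub, map_smul, map_smul,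
    coefY_mon, coefY_mon, coefX_mon, formCoeff_eq, formCoeff_eq]
  simp [push, tot_succ, parity]
  split_ifs <;> simp_all

theorem eq_coefX_smul {m : ℕ} {x : Ch 0} (hx : x ∈ (alg R p).chainDeg 0 m) :
    x = coefX R m x • mon R 0 (fun _ => m) := by
  rw [chainDeg_eq_span] at hx
  induction hx using Submodule.span_induction with
  | mem x hx =>
    obtain ⟨e, he, rfl⟩ := hx
    have he' : e 0 = m := by simpa [tot_succ] using he
    rw [coefX_mon, if_pos he', one_smul]
    refine mon_congr R fun i hi => ?_
    rw [Nat.le_zero.1 hi, he']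
  | zero => simp
  | add x y _ _ hx hy => rw [map_add, add_smul, ← hx, ← hy]
  | smul c x _ hx => rw [map_smul, smul_assoc, ← hx]

theorem formProj_eq_coefY_smul {m : ℕ} {x : Ch 1} (hx : x ∈ (alg R p).chainDeg 1 m) :
    formProj R x = coefY R m x • mon R 1 (pairExp (m - 1) 1) := by
  rw [chainDeg_eq_span] at hx
  induction hx using Submodule.span_induction with
  | mem x hx =>
    obtain ⟨e, he, rfl⟩ := hx
    have he' : e 0 + e 1 = m := by
      have : tot 2 e = m := by exact_mod_cast he
      simpa [tot_succ] using this
    rw [formProj_mon, coefY_mon, if_pos he', he']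
  | zero => simp
  | add x y _ _ hx hy => rw [map_add, map_add, add_smul, hx, hy]
  | smul c x _ hx => rw [map_smul, map_smul, smul_assoc, hx]

theorem coefY_pairExp (a : ℕ) : coefY R (a + 1) (mon R 1 (pairExp a 1)) = 1 := by
  rw [coefY_mon]
  simp [pairExp, formCoeff]

end Coordinates
end KillP

/-! ### Cyclic homology as a cokernel -/

namespace KillP
section Reduction
variable {R : Type*} [CommRing R] (p : ℕ)

local notation "Ch" => Hoch.Chain R R[X]

theorem coefX_totD (f : (alg R p).Tot) (k m : ℕ) : coefX R m ((alg R p).totD f k 0) =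
    if Even m then 2 * coefY R m (f k 1) + p * coefX R (m + 1) (f k 0) else 0 := by
  rw [totD_apply_zero, map_add, coefX_b, coefX_inner]
  split_ifs <;> simp

theorem coefY_totD (f : (alg R p).Tot) (k m : ℕ) : coefY R m ((alg R p).totD f k 1) =
    if Odd m then m * coefX R m (f (k + 1) 0) - p * coefY R (m + 1) (f k 1) else 0 := by
  rw [totD_apply_succ, map_add, map_add, coefY_b, map_smul, coefY_inner, coefY_connes]
  split_ifs <;> simp
  ring

theorem eq_zero_of_coefX {q : ℤ} {x : Ch 0} (hx : x ∈ (alg R p).chainDeg 0 q)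
    (h : ∀ m : ℕ, (m : ℤ) = q → coefX R m x = 0) : x = 0 := by
  rcases lt_or_ge q 0 with hq | hq
  · rwa [chainDeg_eq_bot p hq, Submodule.mem_bot] at hx
  · lift q to ℕ using hq
    rw [eq_coefX_smul p hx, h q rfl, zero_smul]

theorem formProj_eq_zero_of_coefY {q : ℤ} {x : Ch 1} (hx : x ∈ (alg R p).chainDeg 1 q)
    (h : ∀ m : ℕ, (m : ℤ) = q → coefY R m x = 0) : formProj R x = 0 := by
  rcases lt_or_ge q 0 with hq | hq
  · rw [chainDeg_eq_bot p hq, Submodule.mem_bot] at hx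
    rw [hx, map_zero]
  · lift q to ℕ using hq
    rw [formProj_eq_coefY_smul p hx, h q rfl, zero_smul]

/-- `exists_totD_eq` in coordinates: a cycle is a boundary as soon as all its coordinates `coefX` and
`coefY` in the relevant degrees vanish. -/
theorem exists_totD_eq_of_coef {m : ℤ} {f : (alg R p).Tot} (hf : f ∈ (alg R p).totDeg m)
    (hD : (alg R p).totD f = 0) (hX : ∀ k l : ℕ, (l : ℤ) = m - 2 * k → coefX R l (f k 0) = 0)
    (hY : ∀ k l : ℕ, (l : ℤ) = m - 2 * k - 1 → coefY R l (f k 1) = 0) :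
    ∃ w ∈ (alg R p).totDeg (m + 1), (∀ k, w k 0 = 0 ∧ w k 1 = 0) ∧ (alg R p).totD w = f := by
  have hf' := (mem_totDeg p).1 hf
  refine exists_totD_eq p hf hD (fun k => ?_) fun k => ?_
  · refine eq_zero_of_coefX p (hf' k 0) fun l hl => hX k l ?_
    rw [hl]
    push_cast
    ring
  · refine formProj_eq_zero_of_coefY p (hf' k 1) fun l hl => hY k l ?_
    rw [hl]
    push_cast
    ring

variable {p}

theorem subsingleton_HC_of_odd (hR : ∀ r : R, (p : R) * r = 0 → r = 0) {i : ℤ} (hi : Odd i) :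
    Subsingleton ((alg R p).HC i) := by
  rw [Submodule.Quotient.subsingleton_iff, Submodule.submoduleOf, Submodule.comap_subtype_eq_top]
  rintro f ⟨hf, hD⟩
  rw [SetLike.mem_coe, LinearMap.mem_ker] at hD
  -- going up from the exponent `1`, the coordinates vanish one column after the other
  have key : ∀ r k : ℕ, i = 2 * k + 2 * r + 1 →
      coefX R (2 * r + 1) (f k 0) = 0 ∧ coefY R (2 * r) (f k 1) = 0 := by
    intro r
    induction r with
    | zero =>
      intro k _
      have h1 := coefX_totD p f k 0
      rw [hD, if_pos Even.zero, coefY_zero] at h1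
      refine ⟨hR _ ?_, by rw [mul_zero, coefY_zero]; rfl⟩
      simpa using h1.symm
    | succ r ih =>
      intro k hk
      have h0 := (ih (k + 1) (by rw [hk]; push_cast; ring)).1
      have h1 := coefY_totD p f k (2 * r + 1)
      have h2 := coefX_totD p f k (2 * r + 2)
      rw [hD, if_pos ⟨r, rfl⟩, h0, mul_zero, zero_sub] at h1
      have hY : coefY R (2 * (r + 1)) (f k 1) = 0 := by
        refine hR _ (neg_eq_zero.1 ?_)
        rw [mul_add, mul_one]
        simpa using h1.symm
      refine ⟨hR _ ?_, hY⟩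
      rw [mul_add, mul_one] at hY ⊢
      rw [hD, if_pos ⟨r + 1, by ring⟩, hY, mul_zero] at h2
      simpa using h2.symm
  obtain ⟨c, hc⟩ := hi
  obtain ⟨w, hw, -, rfl⟩ := exists_totD_eq_of_coef p hf hD
    (fun k l hl => by
      obtain ⟨r, rfl⟩ : ∃ r, l = 2 * r + 1 := ⟨l / 2, by omega⟩
      exact (key r k (by omega)).1)
    (fun k l hl => by
      obtain ⟨r, rfl⟩ : ∃ r, l = 2 * r := ⟨l / 2, by omega⟩
      exact (key r k (by omega)).2)
  exact ⟨w, hw, rfl⟩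

variable (R p) in
/-- The matrix, with diagonal `p, p², …, p²` and subdiagonal `2, 6, 10, …`, that presents the cyclic
homology in an even degree: applied to `v`, it gives the coordinates `evenCoord` of the differential
of `∑ v l • uʰ⁻ˡ x^(2l+1)`, where `u` stands for a shift by one column. -/
def bidiag (v : ℕ → R) : ℕ → R
  | 0 => p * v 0
  | l + 1 => 2 * ((2 * l + 1 : ℕ) : R) * v l + (p : R) ^ 2 * v (l + 1)

variable (R p) in
/-- The coordinates on chains of degree `2h` that detect homology: the coefficient of `1` in column
`h`, and twice the coefficient of `x^(2l-2) dx` in column `h - l`, after `x^(2l)` in the same column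
has been traded for `p / 2` times that form. -/
noncomputable def evenCoord (h : ℕ) : (alg R p).Tot →ₗ[R] (Fin (h + 1) → R) :=
  LinearMap.pi fun l => if (l : ℕ) = 0 then coefX R 0 ∘ₗ LinearMap.proj 0 ∘ₗ LinearMap.proj h else
    (2 : R) • (coefY R (2 * l - 1) ∘ₗ LinearMap.proj 1 ∘ₗ LinearMap.proj (h - l)) +
      (p : R) • (coefX R (2 * l) ∘ₗ LinearMap.proj 0 ∘ₗ LinearMap.proj (h - l))

theorem evenCoord_zero (h : ℕ) (f : (alg R p).Tot) : evenCoord R p h f 0 = coefX R 0 (f h 0) := by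
  simp [evenCoord]

theorem evenCoord_succ (h l : ℕ) (hl : l + 1 < h + 1) (f : (alg R p).Tot) :
    evenCoord R p h f ⟨l + 1, hl⟩ = 2 * coefY R (2 * l + 1) (f (h - (l + 1)) 1) +
      p * coefX R (2 * l + 2) (f (h - (l + 1)) 0) := by
  simp [evenCoord, mul_add]

theorem evenCoord_totD (h : ℕ) (g : (alg R p).Tot) (l : Fin (h + 1)) :
    evenCoord R p h ((alg R p).totD g) l =
      bidiag R p (fun l => coefX R (2 * l + 1) (g (h - l) 0)) l := by
  obtain ⟨l, hl⟩ := l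
  rcases l with _ | l
  · change evenCoord R p h _ 0 = _
    rw [evenCoord_zero, coefX_totD, if_pos Even.zero, coefY_zero]
    simp [bidiag]
  · rw [evenCoord_succ, coefX_totD, coefY_totD, if_pos ⟨l, rfl⟩, if_pos ⟨l + 1, by ring⟩]
    simp only [bidiag]
    rw [show h - (l + 1) + 1 = h - l by omega, show 2 * l + 1 + 1 = 2 * l + 2 by ring,
      show 2 * (l + 1) + 1 = 2 * l + 2 + 1 by ring]
    ring

/-- The element of the total complex of degree `m` with prescribed coordinates in Hochschild degrees
zero and one. -/
noncomputable def ofCoord (p : ℕ) (m : ℤ) (x y : ℕ → R) : (alg R p).Tot := fun k n =>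
  match n with
  | 0 => if 0 ≤ m - 2 * k then x k • mon R 0 (fun _ => (m - 2 * k).toNat) else 0
  | 1 => if 2 ≤ m - 2 * k then y k • mon R 1 (pairExp ((m - 2 * k).toNat - 2) 1) else 0
  | _ + 2 => 0

theorem ofCoord_mem (m : ℤ) (x y : ℕ → R) : ofCoord p m x y ∈ (alg R p).totDeg m := by
  rw [mem_totDeg]
  intro k n
  rcases n with _ | _ | n
  · change ite _ _ _ ∈ _
    split_ifs with h
    · refine Submodule.smul_mem _ _ (mon_mem_chainDeg p _ ?_)
      rw [tot_succ, tot_zero]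
      push_cast
      omega
    · exact Submodule.zero_mem _
  · change ite _ _ _ ∈ _
    split_ifs with h
    · refine Submodule.smul_mem _ _ (mon_mem_chainDeg p _ ?_)
      rw [tot_succ, tot_succ, tot_zero]
      simp only [pairExp]
      push_cast
      norm_num
      omega
    · exact Submodule.zero_mem _
  · exact Submodule.zero_mem _

theorem coefX_ofCoord {m : ℤ} (x y : ℕ → R) {k l : ℕ} (h : (l : ℤ) = m - 2 * k) :
    coefX R l (ofCoord p m x y k 0) = x k := by
  change coefX R l (ite _ _ _) = _
  rw [if_pos (by omega), map_smul, coefX_mon, if_pos (by omega), smul_eq_mul, mul_one]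

theorem coefY_ofCoord {m : ℤ} (x y : ℕ → R) {k l : ℕ} (h : (l : ℤ) + 2 = m - 2 * k) :
    coefY R (l + 1) (ofCoord p m x y k 1) = y k := by
  change coefY R (l + 1) (ite _ _ _) = _
  rw [if_pos (by omega), map_smul, show (m - 2 * k).toNat - 2 = l by omega, coefY_pairExp,
    smul_eq_mul, mul_one]

/-- Every family of coordinates in an even degree is attained by a cycle. -/
theorem exists_cycle_evenCoord (h2 : IsUnit (2 : R)) (h : ℕ) (c : Fin (h + 1) → R) :
    ∃ f ∈ (alg R p).cycles (2 * h : ℤ), evenCoord R p h f = c := by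
  obtain ⟨half, hhalf⟩ := h2.exists_right_inv
  set f : (alg R p).Tot := ofCoord p (2 * h)
    (fun k => if k = h then c 0 else 0) (fun k => half * c (Fin.ofNat (h + 1) (h - k))) with hf
  have hfm : f ∈ (alg R p).totDeg (2 * h - 1 + 1) := by
    rw [sub_add_cancel]
    exact ofCoord_mem _ _ _
  -- all coordinates of `totD f` vanish for reasons of parity
  obtain ⟨w, hw, hw0, hwD⟩ := exists_totD_eq_of_coef p (totD_mem p hfm) (totD_totD p f)
    (fun k l hl => by
      rw [coefX_totD, if_neg]
      rintro ⟨r, rfl⟩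
      omega)
    (fun k l hl => by
      rw [coefY_totD, if_neg]
      rintro ⟨r, rfl⟩
      omega)
  rw [sub_add_cancel] at hw hfm
  refine ⟨f - w, ⟨Submodule.sub_mem _ hfm hw, ?_⟩, ?_⟩
  · rw [SetLike.mem_coe, LinearMap.mem_ker, map_sub, hwD, sub_self]
  · funext ⟨l, hl⟩
    rcases l with _ | l
    · change evenCoord R p h _ 0 = c 0
      rw [evenCoord_zero, Pi.sub_apply, Pi.sub_apply, (hw0 h).1, sub_zero, hf,
        coefX_ofCoord _ _ (by simp), if_pos rfl]
    · rw [evenCoord_succ, Pi.sub_apply, Pi.sub_apply, Pi.sub_apply, (hw0 _).1, (hw0 _).2, sub_zero,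
        sub_zero, hf, coefX_ofCoord _ _ (by omega), coefY_ofCoord _ _ (by omega),
        if_neg (by omega), mul_zero, add_zero, ← mul_assoc, hhalf, one_mul]
      congr 1
      ext
      simp only [Fin.ofNat]
      rw [show h - (h - (l + 1)) = l + 1 by omega, Nat.mod_eq_of_lt hl]

theorem mem_boundaries_of_evenCoord (h2 : IsUnit (2 : R)) (h : ℕ)
    {f : (alg R p).Tot} (hf : f ∈ (alg R p).cycles (2 * h : ℤ)) (v : ℕ → R)
    (hv : ∀ l, evenCoord R p h f l = bidiag R p v l) : f ∈ (alg R p).boundaries (2 * h : ℤ) := by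
  obtain ⟨hfm, hfD⟩ := hf
  rw [SetLike.mem_coe, LinearMap.mem_ker] at hfD
  obtain ⟨half, hhalf⟩ := h2.exists_right_inv
  -- the forms in `g` are chosen so as to kill the even powers of `x` in `f - totD g`
  set g : (alg R p).Tot := ofCoord p (2 * h + 1) (fun k => v (h - k))
    (fun k => half * (coefX R (2 * (h - k)) (f k 0) - p * v (h - k))) with hg
  have hgm : g ∈ (alg R p).totDeg (2 * h + 1) := ofCoord_mem _ _ _
  have hgX : ∀ l ≤ h, coefX R (2 * l + 1) (g (h - l) 0) = v l := by
    intro l hl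
    rw [hg, coefX_ofCoord _ _ (by omega), show h - (h - l) = l by omega]
  have hzD : (alg R p).totD (f - (alg R p).totD g) = 0 := by rw [map_sub, hfD, totD_totD, sub_zero]
  have hzc : ∀ l, evenCoord R p h (f - (alg R p).totD g) l = 0 := by
    intro l
    rw [map_sub, Pi.sub_apply, hv, evenCoord_totD, sub_eq_zero]
    obtain ⟨l, hl⟩ := l
    rcases l with _ | l
    · simp only [bidiag]
      rw [← hgX 0 (by omega)]
    · simp only [bidiag]
      rw [← hgX l (by omega), ← hgX (l + 1) (by omega)]
  have hzX : ∀ l ≤ h, coefX R (2 * l) ((f - (alg R p).totD g) (h - l) 0) = 0 := by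
    intro l hl
    rcases l with _ | l
    · exact (evenCoord_zero h _).symm.trans (hzc 0)
    · rw [Pi.sub_apply, Pi.sub_apply, map_sub, coefX_totD, if_pos ⟨l + 1, by ring⟩, hgX _ hl, hg,
        show 2 * (l + 1) = 2 * l + 1 + 1 by ring, coefY_ofCoord _ _ (by omega), ← mul_assoc, hhalf,
        show h - (h - (l + 1)) = l + 1 by omega, show 2 * (l + 1) = 2 * l + 1 + 1 by ring]
      ring
  have hzY : ∀ l, l + 1 ≤ h →
      coefY R (2 * l + 1) ((f - (alg R p).totD g) (h - (l + 1)) 1) = 0 := by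
    intro l hl
    have h1 := hzc ⟨l + 1, by omega⟩
    have h3 := hzX (l + 1) hl
    rw [mul_add, mul_one] at h3
    rw [evenCoord_succ, h3, mul_zero, add_zero] at h1
    exact h2.mul_right_eq_zero.1 h1
  obtain ⟨w, hw, -, hwD⟩ := exists_totD_eq_of_coef p (Submodule.sub_mem _ hfm (totD_mem p hgm)) hzD
    (fun k l hl => by
      obtain ⟨r, rfl⟩ : ∃ r, l = 2 * r := ⟨l / 2, by omega⟩
      obtain rfl : k = h - r := by omega
      exact hzX r (by omega))
    (fun k l hl => by
      obtain ⟨r, rfl⟩ : ∃ r, l = 2 * r + 1 := ⟨l / 2, by omega⟩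
      obtain rfl : k = h - (r + 1) := by omega
      exact hzY r (by omega))
  exact ⟨g + w, Submodule.add_mem _ hgm hw, by rw [map_add, hwD]; abel⟩

/-- The cyclic homology in degree `2h` is the cokernel of `bidiag`. -/
theorem HC_even_equiv (h2 : IsUnit (2 : R)) (h : ℕ)
    {Q : Type*} [AddCommGroup Q] [Module R Q] (Φ : (Fin (h + 1) → R) →ₗ[R] Q)
    (hΦ : Function.Surjective Φ)
    (hker : ∀ c, Φ c = 0 ↔ ∃ v : ℕ → R, ∀ l : Fin (h + 1), c l = bidiag R p v l) :
    Nonempty ((alg R p).HC (2 * h : ℤ) ≃ₗ[R] Q) := by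
  set Ψ : (alg R p).cycles (2 * h : ℤ) →ₗ[R] Q :=
    Φ ∘ₗ evenCoord R p h ∘ₗ ((alg R p).cycles (2 * h : ℤ)).subtype with hΨ
  have hsurj : Function.Surjective Ψ := by
    intro q
    obtain ⟨c, rfl⟩ := hΦ q
    obtain ⟨f, hf, rfl⟩ := exists_cycle_evenCoord (p := p) h2 h c
    exact ⟨⟨f, hf⟩, rfl⟩
  have hk : ((alg R p).boundaries (2 * h : ℤ)).submoduleOf ((alg R p).cycles (2 * h : ℤ)) =
      LinearMap.ker Ψ := by
    ext ⟨f, hf⟩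
    rw [LinearMap.mem_ker]
    change f ∈ (alg R p).boundaries _ ↔ Φ (evenCoord R p h f) = 0
    rw [hker]
    constructor
    · rintro ⟨g, -, rfl⟩
      exact ⟨_, evenCoord_totD h g⟩
    · rintro ⟨v, hv⟩
      exact mem_boundaries_of_evenCoord h2 h hf v hv
  exact ⟨(Submodule.quotEquivOfEq _ _ hk).trans (Ψ.quotKerEquivOfSurjective hsurj)⟩

end Reduction
end KillP

/-! ### Valuations of products of odd numbers -/

namespace KillP
section Valuations

variable (p : ℕ)

/-- The `p`-adic valuation of the product of the odd numbers `2s + 1` with `a ≤ s < b`. -/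
def oddVal (a b : ℕ) : ℕ := ∑ s ∈ Finset.Ico a b, padicValNat p (2 * s + 1)

theorem oddVal_self (a : ℕ) : oddVal p a a = 0 := by simp [oddVal]

theorem oddVal_succ {a b : ℕ} (h : a ≤ b) :
    oddVal p a (b + 1) = oddVal p a b + padicValNat p (2 * b + 1) := Finset.sum_Ico_succ_top h _

theorem oddVal_add {a b c : ℕ} (hab : a ≤ b) (hbc : b ≤ c) :
    oddVal p a b + oddVal p b c = oddVal p a c := Finset.sum_Ico_consecutive _ hab hbc

theorem oddVal_eq_add {a b : ℕ} (h : a < b) :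
    oddVal p a b = padicValNat p (2 * a + 1) + oddVal p (a + 1) b :=
  Finset.sum_eq_sum_Ico_succ_bot h _

theorem exists_max_padicValNat {a b : ℕ} (h : a < b) : ∃ s, a ≤ s ∧ s < b ∧
    ∀ t, a ≤ t → t < b → padicValNat p (2 * t + 1) ≤ padicValNat p (2 * s + 1) := by
  obtain ⟨s, hs, hmax⟩ := Finset.exists_max_image (Finset.Ico a b)
    (fun t => padicValNat p (2 * t + 1)) (Finset.nonempty_Ico.2 h)
  rw [Finset.mem_Ico] at hs
  exact ⟨s, hs.1, hs.2, fun t h1 h2 => hmax t (Finset.mem_Ico.2 ⟨h1, h2⟩)⟩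

variable [hp : Fact p.Prime]

theorem padicValRat_seqA (l : ℕ) :
    padicValRat p (seqA p (2 * l + 1)) = 2 * l + 1 - (oddVal p 0 (l + 1) : ℤ) := by
  have hp0 : (p : ℚ) ≠ 0 := by exact_mod_cast hp.out.ne_zero
  induction l with
  | zero => simp [seqA, oddVal, padicValRat.self hp.out.one_lt]
  | succ l ih =>
    have hj : (((2 * l + 1) + 2 : ℕ) : ℚ) ≠ 0 := by positivity
    have h0 := (seqA_spec p l).1
    rw [show 2 * (l + 1) + 1 = (2 * l + 1) + 2 by ring, seqA,
      padicValRat.div (mul_ne_zero (pow_ne_zero _ hp0) h0) hj,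
      padicValRat.mul (pow_ne_zero _ hp0) h0, padicValRat.pow, padicValRat.self hp.out.one_lt, ih,
      padicValRat.of_nat, oddVal_succ p (Nat.zero_le (l + 1)),
      show 2 * (l + 1) + 1 = 2 * l + 1 + 2 by ring]
    push_cast
    ring

theorem seqa_add_oddVal (l : ℕ) : seqa p (2 * l + 1) + oddVal p 0 (l + 1) = 2 * l + 1 := by
  have h1 := coe_seqa p (2 * l + 1) ⟨l, rfl⟩
  rw [padicValRat_seqA] at h1
  omega

theorem padicValNat_factorial_le (n : ℕ) : padicValNat p n.factorial ≤ n := by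
  have h := sub_one_mul_padicValNat_factorial (p := p) n
  have hp2 : 1 ≤ p - 1 := by have := hp.out.two_le; omega
  have := Nat.le_mul_of_pos_left (padicValNat p n.factorial) hp2
  omega

theorem sum_padicValNat_le (n : ℕ) : ∑ i ∈ Finset.range n, padicValNat p (i + 1) ≤ n := by
  have h : ∑ i ∈ Finset.range n, padicValNat p (i + 1) = padicValNat p n.factorial := by
    induction n with
    | zero => simp
    | succ n ih =>
      rw [Finset.sum_range_succ, ih, Nat.factorial_succ,
        padicValNat.mul (by omega) n.factorial_ne_zero, add_comm]
  rw [h]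
  exact padicValNat_factorial_le p n

variable {p}

/-- A power of `p` that divides both `2s + 1` and `2t + 1` divides their difference `2d`, and hence
`d`. -/
theorem padicValNat_odd_le (hodd : Odd p) {s t d : ℕ} (hd : d ≠ 0)
    (hst : s + d = t ∨ t + d = s)
    (h : padicValNat p (2 * s + 1) ≤ padicValNat p (2 * t + 1)) :
    padicValNat p (2 * s + 1) ≤ padicValNat p d := by
  rw [← padicValNat_dvd_iff_le hd]
  have h1 : p ^ padicValNat p (2 * s + 1) ∣ 2 * s + 1 := pow_padicValNat_dvd
  have h2 : p ^ padicValNat p (2 * s + 1) ∣ 2 * t + 1 :=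
    (pow_dvd_pow p h).trans pow_padicValNat_dvd
  have h3 : p ^ padicValNat p (2 * s + 1) ∣ 2 * d := by
    rcases hst with rfl | rfl
    · rw [show 2 * (s + d) + 1 = 2 * s + 1 + 2 * d by ring] at h2
      exact (Nat.dvd_add_right h1).1 h2
    · rw [show 2 * (t + d) + 1 = 2 * t + 1 + 2 * d by ring] at h1 h2 ⊢
      exact (Nat.dvd_add_right h2).1 h1
  exact (Nat.Coprime.pow_left _ (Nat.coprime_two_right.2 hodd)).dvd_of_dvd_mul_left h3

/-- The odd numbers after one of maximal valuation contribute at most the valuation of a factorial. -/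
theorem oddVal_after_max_le (hodd : Odd p) {s b : ℕ} (hs : s < b)
    (h : ∀ t, s < t → t < b → padicValNat p (2 * t + 1) ≤ padicValNat p (2 * s + 1)) :
    oddVal p (s + 1) b ≤ b - (s + 1) := by
  rw [oddVal, Finset.sum_Ico_eq_sum_range]
  refine le_trans (Finset.sum_le_sum fun i hi => ?_) (sum_padicValNat_le p (b - (s + 1)))
  have := Finset.mem_range.1 hi
  exact padicValNat_odd_le hodd (by omega) (Or.inr (by ring)) (h _ (by omega) (by omega))

theorem oddVal_before_max_le (hodd : Odd p) {s a : ℕ} (hs : a ≤ s)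
    (h : ∀ t, a ≤ t → t < s → padicValNat p (2 * t + 1) ≤ padicValNat p (2 * s + 1)) :
    oddVal p a s ≤ s - a := by
  rw [oddVal, Finset.sum_Ico_eq_sum_range, ← Finset.sum_range_reflect]
  refine le_trans (Finset.sum_le_sum fun i hi => ?_) (sum_padicValNat_le p (s - a))
  have := Finset.mem_range.1 hi
  exact padicValNat_odd_le hodd (by omega) (Or.inl (by omega)) (h _ (by omega) (by omega))

/-- Suppose that the product of the `2s + 1` with `k < s < l'` has valuation at most `2(l'-k-1)` for
all `l' ≤ l`, but not for `l' = l + 1`. Then the valuation of `2l + 1` is the largest among those of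
`2k + 1, …, 2l + 1`, and so the product of the other ones has small valuation. -/
theorem oddVal_le_of_first_failure (hodd : Odd p) {k l : ℕ} (hkl : k < l)
    (hgood : ∀ l', k < l' → l' ≤ l → oddVal p (k + 1) l' ≤ 2 * (l' - (k + 1)))
    (hbad : 2 * (l - k) < oddVal p (k + 1) (l + 1)) : oddVal p k l ≤ 2 * (l - k) := by
  obtain ⟨s, hks, hsl, hmax⟩ := exists_max_padicValNat p (show k < l + 1 by omega)
  have hafter := oddVal_after_max_le hodd hsl fun t h1 h2 => hmax t (by omega) h2
  have hbefore := oddVal_before_max_le hodd hks fun t h1 h2 => hmax t h1 (by omega)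
  rcases Nat.lt_or_ge s l with h | h
  · rcases Nat.lt_or_ge k s with h' | h'
    · have h1 := oddVal_add p (show k + 1 ≤ s + 1 by omega) (show s + 1 ≤ l + 1 by omega)
      have h2 := hgood (s + 1) (by omega) (by omega)
      omega
    · obtain rfl : k = s := by omega
      omega
  · obtain rfl : s = l := by omega
    omega

/-- If `2(2h - 1)` is `p^a + 1` or `p^a - 1`, the odd numbers up to `2h - 1` have, modulo `p^a`, the
same valuations as the small numbers `4t ± 1`. -/
theorem oddVal_le_of_pow (hodd : Odd p) {a h k : ℕ} (ha0 : 0 < a)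
    (ha : p ^ a + 3 = 4 * h ∨ p ^ a + 1 = 4 * h)
    (hk : k < h) : oddVal p k h ≤ 2 * (h - k) := by
  obtain ⟨s, hks, hsh, hmax⟩ := exists_max_padicValNat p hk
  have hafter := oddVal_after_max_le hodd hsh fun t h1 h2 => hmax t (by omega) h2
  have hbefore := oddVal_before_max_le hodd hks fun t h1 h2 => hmax t h1 (by omega)
  have h1 := oddVal_add p hks hsh.le
  rw [oddVal_eq_add p hsh] at h1
  set v := padicValNat p (2 * s + 1) with hv
  have h3 : 3 ≤ p := by have := hp.out.two_le; obtain ⟨e, he⟩ := hodd; omega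
  have hdvd : p ^ v ∣ 4 * s + 2 := by
    rw [show 4 * s + 2 = (2 * s + 1) * 2 by ring]
    exact Dvd.dvd.mul_right pow_padicValNat_dvd 2
  have hva : v < a := by
    by_contra hva
    obtain ⟨c, hc⟩ := (pow_dvd_pow p (not_lt.1 hva)).trans hdvd
    obtain ⟨d, hd⟩ := hodd.pow (n := a)
    have h2 : p ≤ p ^ a := Nat.le_self_pow ha0.ne' p
    rcases c with _ | _ | c
    · omega
    · omega
    · have h4 : p ^ a * 2 ≤ p ^ a * (c + 1 + 1) := Nat.mul_le_mul_left _ (by omega)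
      omega
  -- `p^a - (4s + 2)` is one of the numbers `4t ± 1` with `t < h - k`
  have hsmall : p ^ v ≤ 4 * (h - k) := by
    have h2 : (p : ℤ) ^ v ∣ 4 * s + 2 := by exact_mod_cast hdvd
    have h8 : (p : ℤ) ^ v ∣ (p : ℤ) ^ a - (4 * s + 2) := dvd_sub (pow_dvd_pow _ hva.le) h2
    have h4 : ((p ^ a : ℕ) : ℤ) = (p : ℤ) ^ a := by push_cast; rfl
    rw [← h4] at h8
    have h5 := Int.le_of_dvd (b := |((p ^ a : ℕ) : ℤ) - (4 * s + 2)|)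
      (abs_pos.2 (by omega)) ((dvd_abs _ _).2 h8)
    have h6 : |((p ^ a : ℕ) : ℤ) - (4 * s + 2)| ≤ 4 * (h - k) := abs_le.2 (by omega)
    have h7 := h5.trans h6
    zify [hk.le]
    exact h7
  have hvm : v ≤ h - k + 1 := by
    by_contra hvm
    have h4 : 3 ^ (h - k + 2) ≤ p ^ v :=
      (Nat.pow_le_pow_left h3 _).trans (Nat.pow_le_pow_right (by omega) (by omega))
    have h5 : h - k < 3 ^ (h - k) := Nat.lt_pow_self (by norm_num)
    rw [pow_add] at h4
    omega
  omega

end Valuations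
end KillP

/-! ### Diagonalizing the presentation matrix -/

namespace KillP
section Cokernel

variable {R : Type*} [CommRing R] {p : ℕ}

theorem isUnit_natCast_of_coprime [Fact p.Prime] [Algebra (ZLoc p) R] {m : ℕ}
    (hm : p.Coprime m) : IsUnit (m : R) := by
  have h : IsUnit (algebraMap ℤ (ZLoc p) m) := by
    refine IsLocalization.map_units (M := (Ideal.span {(p : ℤ)}).primeCompl) (ZLoc p) ⟨(m : ℤ), ?_⟩
    intro h
    rw [SetLike.mem_coe, Ideal.mem_span_singleton, Int.natCast_dvd_natCast] at h
    have := Nat.eq_one_of_dvd_coprimes hm dvd_rfl h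
    exact (Fact.out : p.Prime).one_lt.ne' this
  have h2 := h.map (algebraMap (ZLoc p) R)
  simpa using h2

/-- Up to units of `R`, the subdiagonal entries of `bidiag` are powers of `p`. -/
theorem exists_unit_mul_eq_pow [Fact p.Prime] [Algebra (ZLoc p) R] (hodd : Odd p) (l : ℕ) :
    ∃ u : Rˣ, (u : R) * (2 * ((2 * l + 1 : ℕ) : R)) = (p : R) ^ padicValNat p (2 * l + 1) := by
  have hpp : p.Prime := Fact.out
  obtain ⟨m, hm⟩ : p ^ padicValNat p (2 * l + 1) ∣ 2 * l + 1 := pow_padicValNat_dvd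
  have hcop : p.Coprime (2 * m) := by
    refine Nat.Coprime.mul_right (Nat.coprime_two_right.2 hodd) ?_
    rw [hpp.coprime_iff_not_dvd]
    intro hdvd
    have : p ^ (padicValNat p (2 * l + 1) + 1) ∣ 2 * l + 1 := by
      conv_rhs => rw [hm]
      rw [pow_succ]
      exact mul_dvd_mul_left _ hdvd
    rw [padicValNat_dvd_iff_le (by omega)] at this
    omega
  obtain ⟨u, hu⟩ := isUnit_natCast_of_coprime (R := R) hcop
  refine ⟨u⁻¹, ?_⟩
  rw [Units.inv_mul_eq_iff_eq_mul, hu]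
  conv_lhs => rw [hm]
  push_cast
  ring

theorem natCast_dvd_pow {u : Rˣ} {l m : ℕ}
    (hu : (u : R) * (2 * ((2 * l + 1 : ℕ) : R)) = (p : R) ^ padicValNat p (2 * l + 1))
    (h : padicValNat p (2 * l + 1) ≤ m) : ((2 * l + 1 : ℕ) : R) ∣ (p : R) ^ m := by
  refine dvd_trans ?_ (pow_dvd_pow _ h)
  rw [← hu, ← mul_assoc]
  exact dvd_mul_left _ _

/-- The first row of the change of basis: it is annihilated by all columns of `bidiag` but the
last. -/
theorem exists_row_zero [hp : Fact p.Prime] {u : ℕ → Rˣ}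
    (hu : ∀ l, (u l : R) * (2 * ((2 * l + 1 : ℕ) : R)) = (p : R) ^ padicValNat p (2 * l + 1)) :
    ∃ α : ℕ → R, α 0 = 1 ∧ α 0 * p + α 1 * (2 * ((2 * 0 + 1 : ℕ) : R)) = 0 ∧
      (∀ l, α (l + 1) * (p : R) ^ 2 + α (l + 2) * (2 * ((2 * (l + 1) + 1 : ℕ) : R)) = 0) ∧
      ∀ l, (p : R) ^ (seqa p (2 * l + 1) + 2) ∣ α (l + 1) * (p : R) ^ 2 := by
  refine ⟨fun l => if l = 0 then 1 else
    (-1) ^ l * (p : R) ^ seqa p (2 * l - 1) * ∏ s ∈ Finset.range l, (u s : R), if_pos rfl, ?_, ?_, ?_⟩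
  · have h1 := hu 0
    have h2 := seqa_add_oddVal p 0
    rw [oddVal_succ p le_rfl, oddVal_self] at h2
    simp only [mul_zero, zero_add, padicValNat_one_right, pow_zero, add_zero] at h1 h2
    simp only [one_ne_zero, if_false, if_true, mul_zero, zero_add, mul_one, one_mul,
      Finset.prod_range_one, h2, pow_one, Nat.reduceSub]
    linear_combination -(p : R) * h1
  · intro l
    have h1 := hu (l + 1)
    have h2 := seqa_add_oddVal p l
    have h3 := seqa_add_oddVal p (l + 1)
    rw [oddVal_succ p (Nat.zero_le (l + 1))] at h3
    dsimp only
    rw [if_neg (Nat.succ_ne_zero l), if_neg (Nat.succ_ne_zero (l + 1)),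
      show 2 * (l + 1) - 1 = 2 * l + 1 by omega,
      show 2 * (l + 2) - 1 = 2 * (l + 1) + 1 by omega, Finset.prod_range_succ _ (l + 1),
      show seqa p (2 * l + 1) = seqa p (2 * (l + 1) + 1) + padicValNat p (2 * (l + 1) + 1) - 2 by
        omega]
    have h4 : (p : R) ^ (seqa p (2 * (l + 1) + 1) + padicValNat p (2 * (l + 1) + 1) - 2) *
        (p : R) ^ 2 = (p : R) ^ seqa p (2 * (l + 1) + 1) *
          (p : R) ^ padicValNat p (2 * (l + 1) + 1) := by
      rw [← pow_add, ← pow_add]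
      congr 1
      omega
    rw [← h1] at h4
    rw [pow_succ (-1 : R) (l + 1)]
    linear_combination (-1 : R) ^ (l + 1) * (∏ s ∈ Finset.range (l + 1), (u s : R)) * h4
  · intro l
    dsimp only
    rw [if_neg (Nat.succ_ne_zero l), show 2 * (l + 1) - 1 = 2 * l + 1 by omega, pow_add]
    exact ⟨(-1) ^ (l + 1) * ∏ s ∈ Finset.range (l + 1), (u s : R), by ring⟩

/-- The other rows of the change of basis. The entries are forced by the columns of `bidiag`, as long
as the quotients are integral, and can be taken to be zero from then on. -/
theorem exists_row_succ [hp : Fact p.Prime] (hodd : Odd p) {u : ℕ → Rˣ}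
    (hu : ∀ l, (u l : R) * (2 * ((2 * l + 1 : ℕ) : R)) = (p : R) ^ padicValNat p (2 * l + 1))
    (k : ℕ) : ∃ α : ℕ → R, (∀ l ≤ k, α l = 0) ∧ α (k + 1) = 1 ∧
      (∀ l, k < l → ((2 * k + 1 : ℕ) : R) ∣
        α l * (p : R) ^ 2 + α (l + 1) * (2 * ((2 * l + 1 : ℕ) : R))) ∧
      ∀ h, k < h → oddVal p k h ≤ 2 * (h - k) → ((2 * k + 1 : ℕ) : R) ∣ α h * (p : R) ^ 2 := by
  classical
  set good : ℕ → Prop := fun l => k < l ∧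
    ∀ l', k < l' → l' ≤ l → oddVal p (k + 1) l' ≤ 2 * (l' - (k + 1)) with hgood
  have hval : ∀ l, good l → oddVal p k l ≤ 2 * (l - k) → ∀ c : R,
      ((2 * k + 1 : ℕ) : R) ∣
        c * (p : R) ^ (2 * (l - (k + 1)) - oddVal p (k + 1) l) * (p : R) ^ 2 := by
    intro l hl hkl c
    rw [mul_assoc, ← pow_add]
    refine Dvd.dvd.mul_left (natCast_dvd_pow (hu k) ?_) c
    have h1 := hl.2 l hl.1 le_rfl
    have h2 := hl.1
    rw [oddVal_eq_add p hl.1] at hkl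
    omega
  refine ⟨fun l => if good l then (-1) ^ (l - (k + 1)) * (∏ s ∈ Finset.Ico (k + 1) l, (u s : R)) *
    (p : R) ^ (2 * (l - (k + 1)) - oddVal p (k + 1) l) else 0, ?_, ?_, ?_, ?_⟩
  · intro l hl
    exact if_neg fun h => absurd h.1 (by omega)
  · have h : good (k + 1) := by
      refine ⟨by omega, fun l' h1 h2 => ?_⟩
      rw [show l' = k + 1 by omega, oddVal_self]
      omega
    simp only [if_pos h]
    simp
  · intro l hl
    -- at the first `l` with `¬ good (l + 1)`, the `l`-th entry is itself divisible by `2k + 1`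
    by_cases h1 : good (l + 1)
    · have h0 : good l := ⟨hl, fun l' ha hb => h1.2 l' ha (by omega)⟩
      simp only [if_pos h0, if_pos h1]
      have h2 := h1.2 (l + 1) h1.1 le_rfl
      have h3 := h0.2 l hl le_rfl
      rw [oddVal_succ p (show k + 1 ≤ l by omega)] at h2 ⊢
      rw [Finset.prod_Ico_succ_top (show k + 1 ≤ l by omega),
        show l + 1 - (k + 1) = l - (k + 1) + 1 by omega] at *
      have h4 : (p : R) ^ (2 * (l - (k + 1)) - oddVal p (k + 1) l) * (p : R) ^ 2 =
          (p : R) ^ (2 * (l - (k + 1) + 1) -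
            (oddVal p (k + 1) l + padicValNat p (2 * l + 1))) *
              (p : R) ^ padicValNat p (2 * l + 1) := by
        rw [← pow_add, ← pow_add]
        congr 1
        omega
      rw [← hu l] at h4
      convert dvd_zero _ using 1
      rw [pow_succ (-1 : R)]
      linear_combination
        (-1 : R) ^ (l - (k + 1)) * (∏ s ∈ Finset.Ico (k + 1) l, (u s : R)) * h4
    · simp only [if_neg h1, zero_mul, add_zero]
      by_cases h0 : good l
      · simp only [if_pos h0]
        refine hval l h0 (oddVal_le_of_first_failure hodd hl h0.2 ?_) _
        by_contra h2
        refine h1 ⟨by omega, fun l' ha hb => ?_⟩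
        rcases Nat.lt_or_ge l' (l + 1) with h3 | h3
        · exact h0.2 l' ha (by omega)
        · rw [show l' = l + 1 by omega]
          omega
      · simp only [if_neg h0, zero_mul]
        exact dvd_zero _
  · intro h hk hkh
    by_cases h0 : good h
    · simp only [if_pos h0]
      exact hval h h0 hkh _
    · simp only [if_neg h0, zero_mul]
      exact dvd_zero _

variable (R p) in
/-- The entries of the matrix of `bidiag`. -/
def bidiagEntry (i j : ℕ) : R :=
  (if i = j then (if j = 0 then (p : R) else (p : R) ^ 2) else 0) +
    if i = j + 1 then 2 * ((2 * j + 1 : ℕ) : R) else 0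

theorem sum_bidiagEntry_mul {N i : ℕ} (hi : i < N) (v : ℕ → R) :
    ∑ j ∈ Finset.range N, bidiagEntry R p i j * v j = bidiag R p v i := by
  simp only [bidiagEntry, add_mul, ite_mul, zero_mul, Finset.sum_add_distrib]
  rw [Finset.sum_ite_eq, if_pos (Finset.mem_range.2 hi)]
  rcases i with _ | i
  · simp [bidiag]
  · simp only [Nat.succ_ne_zero, if_false, Nat.add_right_cancel_iff]
    rw [Finset.sum_ite_eq, if_pos (Finset.mem_range.2 (by omega)), bidiag, add_comm]

theorem sum_mul_bidiagEntry {N j : ℕ} (hj : j < N) (w : ℕ → R) :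
    ∑ i ∈ Finset.range N, w i * bidiagEntry R p i j =
      w j * (if j = 0 then (p : R) else (p : R) ^ 2) +
        if j + 1 < N then w (j + 1) * (2 * ((2 * j + 1 : ℕ) : R)) else 0 := by
  simp only [bidiagEntry, mul_add, mul_ite, mul_zero, Finset.sum_add_distrib]
  rw [Finset.sum_ite_eq', Finset.sum_ite_eq', if_pos (Finset.mem_range.2 hj)]
  simp only [Finset.mem_range]

/-- If `U * M = diagonal d * V` with `U` invertible, and `det M` and `det (diagonal d)` agree up to a
unit and are not zero divisors, then `U` identifies the cokernel of `M` with `⨁ R / (dᵢ)`. -/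
theorem range_mulVec_iff_dvd {N : ℕ} {U M V : Matrix (Fin N) (Fin N) R} {d : Fin N → R}
    (hUV : U * M = Matrix.diagonal d * V) (hU : U.det = 1) {w : R} (hw : IsUnit w)
    (hdet : M.det = w * ∏ i, d i) (hreg : ∀ r, M.det * r = 0 → r = 0) (c : Fin N → R) :
    (∃ v, c = M.mulVec v) ↔ ∀ i, d i ∣ U.mulVec c i := by
  have hV : IsUnit V.det := by
    have h1 := congrArg Matrix.det hUV
    rw [Matrix.det_mul, Matrix.det_mul, hU, one_mul, Matrix.det_diagonal] at h1
    have h2 : M.det * (V.det - w) = 0 := by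
      linear_combination V.det * hdet - w * h1
    rwa [sub_eq_zero.1 (hreg _ h2)]
  have hU' : IsUnit U.det := by rw [hU]; exact isUnit_one
  constructor
  · rintro ⟨v, rfl⟩ i
    rw [Matrix.mulVec_mulVec, hUV, ← Matrix.mulVec_mulVec, Matrix.mulVec_diagonal]
    exact dvd_mul_right _ _
  · intro h
    choose e he using h
    refine ⟨V⁻¹.mulVec e, ?_⟩
    have h1 : U.mulVec c = U.mulVec (M.mulVec (V⁻¹.mulVec e)) := by
      rw [Matrix.mulVec_mulVec, hUV, Matrix.mulVec_mulVec, Matrix.mul_assoc,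
        Matrix.mul_nonsing_inv V hV, Matrix.mul_one]
      funext i
      rw [he, Matrix.mulVec_diagonal]
    have h2 := congrArg (U⁻¹.mulVec) h1
    rwa [Matrix.mulVec_mulVec, Matrix.mulVec_mulVec, Matrix.nonsing_inv_mul U hU', Matrix.one_mulVec,
      Matrix.one_mulVec] at h2

variable (R p) in
/-- The annihilators of the cyclic summands of the cokernel of `bidiag`. -/
def summand (h : ℕ) : Fin (h + 1) → R :=
  Fin.cons ((p : R) ^ (seqa p (2 * h - 1) + 2)) fun k : Fin h => ((2 * (k : ℕ) + 1 : ℕ) : R)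

/-- The cokernel of `bidiag` is `R / p^(a+2) ⊕ R / 1 ⊕ R / 3 ⊕ ⋯ ⊕ R / (2h-1)`, through the change of
basis `U`. -/
theorem exists_coker_bidiag [hp : Fact p.Prime] [Algebra (ZLoc p) R] (hodd : Odd p)
    (hR : ∀ r : R, (p : R) * r = 0 → r = 0) {h : ℕ} (hpos : 0 < h)
    (hh : ∀ k < h, oddVal p k h ≤ 2 * (h - k)) :
    ∃ U : Matrix (Fin (h + 1)) (Fin (h + 1)) R, U.det = 1 ∧ ∀ c : Fin (h + 1) → R,
      (∃ v : ℕ → R, ∀ l : Fin (h + 1), c l = bidiag R p v l) ↔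
        ∀ i, summand R p h i ∣ U.mulVec c i := by
  choose u hu using fun l => exists_unit_mul_eq_pow (R := R) hodd l
  obtain ⟨α, hα0, hα1, hα2, hα3⟩ := exists_row_zero hu
  choose β hβ0 hβ1 hβ2 hβ3 using fun k => exists_row_succ hodd hu k
  set U : Matrix (Fin (h + 1)) (Fin (h + 1)) R := Matrix.of fun i j =>
    (Fin.cons (α j) (fun k : Fin h => β k j) : Fin (h + 1) → R) i with hUdef
  set M : Matrix (Fin (h + 1)) (Fin (h + 1)) R :=
    Matrix.of fun i j => bidiagEntry R p i j with hMdef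
  have hU : U.det = 1 := by
    rw [Matrix.det_of_isUpperTriangular]
    · refine Finset.prod_eq_one fun i _ => ?_
      refine Fin.cases ?_ (fun k => ?_) i
      · exact hα0
      · exact hβ1 k
    · intro i j hij
      induction i using Fin.cases with
      | zero => exact absurd hij (by simp)
      | succ k => exact hβ0 k j (Nat.lt_succ_iff.1 hij)
  have hMd : ∀ i : Fin (h + 1), M i i = if (i : ℕ) = 0 then (p : R) else (p : R) ^ 2 := by
    intro i
    simp [hMdef, bidiagEntry]
  have hM : M.det = (p : R) ^ (2 * h + 1) := by
    rw [Matrix.det_of_isLowerTriangular]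
    · rw [Finset.prod_congr rfl fun i _ => hMd i, Fin.prod_univ_succ]
      simp
      ring
    · intro i j hij
      have hij' : i < j := hij
      simp only [hMdef, Matrix.of_apply, bidiagEntry]
      rw [if_neg (by omega), if_neg (by omega), add_zero]
  have hMreg : ∀ r, M.det * r = 0 → r = 0 := by
    rw [hM]
    generalize 2 * h + 1 = n
    intro r hr
    induction n with
    | zero => simpa using hr
    | succ n ih =>
      rw [pow_succ', mul_assoc] at hr
      exact ih (hR _ hr)
  have hUM : ∀ w : ℕ → R, ∀ j : Fin (h + 1), ∑ i : Fin (h + 1), w i * M i j =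
      w j * (if (j : ℕ) = 0 then (p : R) else (p : R) ^ 2) +
        if (j : ℕ) + 1 < h + 1 then w (j + 1) * (2 * ((2 * (j : ℕ) + 1 : ℕ) : R)) else 0 := by
    intro w j
    rw [← sum_mul_bidiagEntry j.2, ← Fin.sum_univ_eq_sum_range (fun i => w i * bidiagEntry R p i j)]
    rfl
  have hdvd : ∀ i j, summand R p h i ∣ (U * M) i j := by
    intro i j
    rw [Matrix.mul_apply]
    obtain ⟨j, hj⟩ := j
    refine Fin.cases ?_ (fun k => ?_) i
    · change (p : R) ^ (seqa p (2 * h - 1) + 2) ∣ ∑ i : Fin (h + 1), α i * M i _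
      rw [hUM α]
      rcases j with _ | j
      · simp only [if_true]
        rw [if_pos (by omega), hα1]
        exact dvd_zero _
      · simp only [Nat.succ_ne_zero, if_false]
        split_ifs with h'
        · rw [hα2]
          exact dvd_zero _
        · obtain rfl : h = j + 1 := by omega
          rw [add_zero, show 2 * (j + 1) - 1 = 2 * j + 1 by omega]
          exact hα3 j
    · change ((2 * (k : ℕ) + 1 : ℕ) : R) ∣ ∑ i : Fin (h + 1), β k i * M i _
      rw [hUM (β k)]
      dsimp only
      rcases lt_trichotomy j k with h1 | h1 | h1
      · rw [hβ0 k j h1.le, hβ0 k (j + 1) h1]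
        simp
      · subst h1
        rw [hβ0 k k le_rfl, zero_mul, zero_add]
        split_ifs
        · exact Dvd.dvd.mul_left (dvd_mul_left _ _) _
        · exact dvd_zero _
      · rw [if_neg (by omega)]
        split_ifs with h'
        · exact hβ2 k j h1
        · obtain rfl : j = h := by omega
          rw [add_zero]
          exact hβ3 k j h1 (hh k k.2)
  choose V hV using hdvd
  have hUV : U * M = Matrix.diagonal (summand R p h) * Matrix.of V := by
    ext i j
    rw [Matrix.diagonal_mul]
    exact hV i j
  have hw : IsUnit (∏ k ∈ Finset.range h, ((u k : R) * 2)) := by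
    have h2 : IsUnit ((2 : ℕ) : R) := isUnit_natCast_of_coprime (Nat.coprime_two_right.2 hodd)
    exact Finset.prod_induction _ IsUnit (fun _ _ => IsUnit.mul) isUnit_one
      fun k _ => (u k).isUnit.mul (by exact_mod_cast h2)
  have hdet : M.det = (∏ k ∈ Finset.range h, ((u k : R) * 2)) * ∏ i, summand R p h i := by
    rw [hM, Fin.prod_univ_succ]
    simp only [summand, Fin.cons_zero, Fin.cons_succ]
    rw [Fin.prod_univ_eq_prod_range (fun k => ((2 * k + 1 : ℕ) : R)), mul_left_comm,
      ← Finset.prod_mul_distrib, Finset.prod_congr rfl fun k _ => (mul_assoc _ _ _).trans (hu k),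
      Finset.prod_pow_eq_pow_sum, ← pow_add]
    congr 1
    have h1 := seqa_add_oddVal p (h - 1)
    rw [show 2 * (h - 1) + 1 = 2 * h - 1 by omega, show h - 1 + 1 = h by omega, oddVal,
      ← Finset.range_eq_Ico] at h1
    omega
  refine ⟨U, hU, fun c => ?_⟩
  rw [← range_mulVec_iff_dvd hUV hU hw hdet hMreg]
  have hMv : ∀ v : ℕ → R, ∀ l : Fin (h + 1), M.mulVec (fun i => v i) l = bidiag R p v l := by
    intro v l
    rw [← sum_bidiagEntry_mul l.2, ← Fin.sum_univ_eq_sum_range (fun j => bidiagEntry R p l j * v j)]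
    rfl
  constructor
  · rintro ⟨v, hv⟩
    exact ⟨fun i => v i, funext fun l => by rw [hv, hMv]⟩
  · rintro ⟨v, rfl⟩
    refine ⟨fun i => if hi : i < h + 1 then v ⟨i, hi⟩ else 0, fun l => ?_⟩
    rw [← hMv]
    congr 2
    funext i
    simp [i.is_le]

end Cokernel
end KillP

/-! ### Proof of the theorem -/

namespace KillP
section Main

variable {R : Type*} [CommRing R] {p : ℕ}

theorem HC_zero_equiv (h2 : IsUnit (2 : R)) :
    Nonempty ((alg R p).HC 0 ≃ₗ[R] (R ⧸ Ideal.span {(p : R)})) := by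
  have h := HC_even_equiv (p := p) h2 0
    ((Ideal.span {(p : R)}).mkQ ∘ₗ LinearMap.proj (R := R) (φ := fun _ : Fin 1 => R) 0)
    ((Submodule.mkQ_surjective _).comp fun r => ⟨fun _ => r, rfl⟩) fun c => by
      rw [LinearMap.comp_apply, Submodule.mkQ_apply, Submodule.Quotient.mk_eq_zero,
        Ideal.mem_span_singleton]
      constructor
      · rintro ⟨r, hr⟩
        refine ⟨fun _ => r, fun l => ?_⟩
        obtain rfl : l = 0 := Fin.ext (by omega)
        exact hr
      · rintro ⟨v, hv⟩
        exact ⟨v 0, hv 0⟩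
  rwa [Nat.cast_zero, mul_zero] at h

theorem HC_even_equiv_prod [Fact p.Prime] [Algebra (ZLoc p) R] (hodd : Odd p)
    (hR : ∀ r : R, (p : R) * r = 0 → r = 0) {h : ℕ} (hpos : 0 < h)
    (hh : ∀ k < h, oddVal p k h ≤ 2 * (h - k)) (h2 : IsUnit (2 : R)) :
    Nonempty ((alg R p).HC (2 * h : ℤ) ≃ₗ[R]
      ((R ⧸ Ideal.span {(p : R) ^ (seqa p (2 * h - 1) + 2)}) ×
        ((k : Fin h) → R ⧸ Ideal.span {((2 * (k : ℕ) + 1 : ℕ) : R)}))) := by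
  obtain ⟨U, hU, hker⟩ := exists_coker_bidiag hodd hR hpos hh
  refine HC_even_equiv (p := p) h2 h (LinearMap.prod
    (Submodule.mkQ _ ∘ₗ LinearMap.proj 0 ∘ₗ U.mulVecLin)
    (LinearMap.pi fun k => Submodule.mkQ _ ∘ₗ LinearMap.proj k.succ ∘ₗ U.mulVecLin)) ?_ fun c => ?_
  · rintro ⟨x, y⟩
    obtain ⟨x, rfl⟩ := Submodule.mkQ_surjective _ x
    choose z hz using fun k => Submodule.mkQ_surjective _ (y k)
    refine ⟨U⁻¹.mulVec (Fin.cons x z), ?_⟩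
    have h1 : U.mulVec (U⁻¹.mulVec (Fin.cons x z)) = Fin.cons x z := by
      rw [Matrix.mulVec_mulVec, Matrix.mul_nonsing_inv U (by rw [hU]; exact isUnit_one),
        Matrix.one_mulVec]
    refine Prod.ext ?_ (funext fun k => ?_)
    · simp [h1]
    · simp [h1, ← hz]
  · rw [hker, Fin.forall_fin_succ, Prod.ext_iff]
    refine and_congr ?_ ?_
    · simp [summand, Ideal.Quotient.eq_zero_iff_mem, Ideal.mem_span_singleton]
    · rw [funext_iff]
      refine forall_congr' fun k => ?_
      simp [summand, Ideal.Quotient.eq_zero_iff_mem, Ideal.mem_span_singleton]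

end Main
end KillP

theorem theorem2 (p : ℕ) [Fact p.Prime] (hp : Odd p)
    (R : Type*) [CommRing R] [Algebra (KillP.ZLoc p) R]
    (hR : ∀ r : R, (p : R) * r = 0 → r = 0) :
    (∀ i : ℤ, Odd i → Subsingleton ((KillP.alg R p).HC i)) ∧
    Nonempty ((KillP.alg R p).HC 0 ≃ₗ[R] (R ⧸ Ideal.span {(p : R)})) ∧
    ∃ Z : Set ℕ, Z.Infinite ∧ (∀ i ∈ Z, 0 < i ∧ Even i) ∧
      (∀ i ∈ Z, Nonempty ((KillP.alg R p).HC (i : ℤ) ≃ₗ[R]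
        ((R ⧸ Ideal.span {(p : R) ^ (KillP.seqa p (i - 1) + 2)}) ×
          ((k : Fin (i / 2)) → R ⧸ Ideal.span {((2 * (k : ℕ) + 1 : ℕ) : R)})))) ∧
      (∀ a : ℕ, 0 < a → ∀ i : ℕ, Even i →
        (i = (p ^ a + 1) / 2 + 1 ∨ i = (p ^ a - 1) / 2 + 1) → i ∈ Z) := by

  have hp3 : 3 ≤ p := by
    have := (Fact.out : p.Prime).two_le
    obtain ⟨d, hd⟩ := hp
    omega
  have h2 : IsUnit (2 : R) := by
    have := KillP.isUnit_natCast_of_coprime (R := R) (Nat.coprime_two_right.2 hp)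
    exact_mod_cast this
  refine ⟨fun i hi => KillP.subsingleton_HC_of_odd hR hi, KillP.HC_zero_equiv h2,
    {i | Even i ∧ ∃ a, 0 < a ∧ (i = (p ^ a + 1) / 2 + 1 ∨ i = (p ^ a - 1) / 2 + 1)}, ?_, ?_, ?_, ?_⟩
  · -- for each `a`, one of the two consecutive numbers is even
    refine Set.infinite_of_not_bddAbove ?_
    rintro ⟨B, hB⟩
    have hlt : 2 * B + 1 < p ^ (2 * B + 1) := Nat.lt_pow_self (by omega)
    obtain ⟨d, hd⟩ := hp.pow (n := 2 * B + 1)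
    rcases Nat.even_or_odd d with he | ho
    · have := hB (a := d + 2) ⟨he.add even_two, 2 * B + 1, by omega, Or.inl (by omega)⟩
      omega
    · have := hB (a := d + 1) ⟨ho.add_one, 2 * B + 1, by omega, Or.inr (by omega)⟩
      omega
  · rintro i ⟨he, a, -, hi⟩
    exact ⟨by omega, he⟩
  · rintro i ⟨⟨h, rfl⟩, a, ha, hi⟩
    obtain ⟨d, hd⟩ := hp.pow (n := a)
    have e : (h + h) / 2 = h := by omega
    rw [e, Nat.cast_add, ← two_mul, ← two_mul]
    exact KillP.HC_even_equiv_prod hp hR (by omega)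
      (fun k hk => KillP.oddVal_le_of_pow hp ha (by omega) hk) h2
  · intro a ha i he hi
    exact ⟨he, a, ha, hi⟩
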